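/- **Theorem 7.2.** *Setting.* A confidence level is a pair $\langle[\alpha,\beta],[\gamma,\delta]\rangle$ (belief, doubt) of intervals with bounds in $[0,1]$; it is consistent if some reals $w_1,w_0,w_\bot\ge 0$ with $w_1+w_0+w_\bot=1$ satisfy $\alpha\le w_1\le\beta$ and $\gamma\le w_0\le\delta$. Put $\langle[\alpha,\beta],[\gamma,\delta]\rangle\le_t\langle[\alpha',\beta'],[\gamma',\delta']\rangle$ iff $\alpha\le\alpha'$, $\beta\le\beta'$, $\gamma'\le\gamma$, $\delta'\le\delta$; the least element is $\bot_t=\langle[0,0],[1,1]\rangle$. Write $a\odot b=\max\{0,a+b-1\}$, $a\oplus b=\min\{1,a+b\}$, $a\star b=1-(1-a)(1-b)$. Conjunction under the modes ignorance, independence, positive correlation, negative correlation, mutual exclusion acts on the bounds $(\alpha,\beta,\gamma,\delta)$ by $$(\odot,\min,\max,\oplus),\quad(\cdot,\cdot,\star,\star),\quad(\min,\min,\max,\max),\quad(\odot,\odot,\oplus,\oplus),\quad(0,0,\oplus,\oplus),$$ and disjunction by $$(\max,\oplus,\odot,\min),\quad(\star,\star,\cdot,\cdot),\quad(\max,\max,\min,\min),\quad(\oplus,\oplus,\odot,\odot),\quad(\oplus,\oplus,\odot,\odot).$$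 A p-program $P$ over a finite set of predicates with given arities is a finite set of function-free, range restricted p-rules. Each is either a fact $A\xleftarrow{c}$ or a rule $(A\xleftarrow{c}B_1,\dots,B_m;\mu_r)$ with $m\ge1$, where $A$ and the $B_i$ are atoms, $c$ is a consistent confidence level and $\mu_r$ is a conjunctive mode. In addition, each predicate has one disjunctive mode. The Herbrand universe is the set of constants occurring in $P$ (one arbitrary constant if there are none), $B_P$ is the set of ground atoms over it, and $P^*$ is the set of ground instances of the p-rules of $P$ over it. A valuation is a map $v$ from $B_P$ to confidence levels; valuations are ordered pointwise by $\le_t$. The operator $T_P$ maps $v$ to the valuation whose value at $A\in B_P$ is the disjunction, in the disjunctive mode of the predicate of $A$, of the confidences $c\wedge_{\mu_r}v(B_1)\wedge_{\mu_r}\cdots\wedge_{\mu_r}v(B_m)$, one for each p-rule in $P^*$ with head $A$ (just $c$ for a fact; $\bot_t$ if there is no such p-rule). A predicate is recursive if it depends on itself, directly or through other predicates, where the head predicate of a rule depends on the predicates in its body. The database size $n$ of $P$ is the number of constants occurring in $P$. *Claim.* Fix the predicates and their arities, the disjunctive modes, a finite set $R$ of rules with nonempty body, and a number $m$. There is a polynomial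 $q$ such that the following holds for every p-program $P$ with these predicates and modes which consists of the rules in $R$ together with ground facts, at most $m$ for each ground atom, and in which every recursive predicate has positive correlation as its disjunctive mode. The operator $T_P$ has a least fixpoint, and naive bottom-up evaluation computes it: starting from the valuation that is constantly $\bot_t$, it applies $T_P$ repeatedly until nothing changes; it halts after at most $q(n)$ iterations (the last, verifying one included), its output is the table of the least fixpoint, each iteration uses at most $q(n)$ elementary operations, and the whole evaluation, including the computation of $P^*$ and $B_P$ from $P$, uses at most $q(n)$ elementary operations. Elementary operations are visits of list cells, equality tests of symbols, and exact comparisons and arithmetic operations on real numbers, each at unit cost. In particular, the least fixpoint of $T_P$ can be computed in time polynomial in the database size. -/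

import Mathlib

noncomputable section

namespace PDatalog

/-! ### Confidence levels -/

/-- The modes of event interaction: ignorance, independence, positive correlation,
negative correlation, mutual exclusion. -/
inductive Mode
  | ig | ind | pc | nc | me

/-- A confidence level `⟨[bLo, bHi], [dLo, dHi]⟩`: a belief interval and a doubt interval
over `[0, 1]`. Empty intervals such as `[1, 0]` are elements, as the top of the precision
order requires. -/
@[ext]
structure Conf where
  bLo : unitInterval
  bHi : unitInterval
  dLo : unitInterval
  dHi : unitInterval

/-- `max {0, a + b - 1}` -/
def luk (a b : unitInterval) : unitInterval :=
  ⟨max 0 ((a : ℝ) + b - 1), le_max_left _ _,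
    max_le zero_le_one (by have := a.2.2; have := b.2.2; linarith)⟩

/-- `min {1, a + b}` -/
def bsum (a b : unitInterval) : unitInterval :=
  ⟨min 1 ((a : ℝ) + b), le_min zero_le_one (add_nonneg a.2.1 b.2.1), min_le_left _ _⟩

/-- `1 - (1 - a) * (1 - b)` -/
def psum (a b : unitInterval) : unitInterval :=
  unitInterval.symm (unitInterval.symm a * unitInterval.symm b)

namespace Conf

/-- Conjunction of confidence levels under a mode. -/
def conj : Mode → Conf → Conf → Conf
  | .ig, c, d => ⟨luk c.bLo d.bLo, min c.bHi d.bHi, max c.dLo d.dLo, bsum c.dHi d.dHi⟩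
  | .ind, c, d => ⟨c.bLo * d.bLo, c.bHi * d.bHi, psum c.dLo d.dLo, psum c.dHi d.dHi⟩
  | .pc, c, d => ⟨min c.bLo d.bLo, min c.bHi d.bHi, max c.dLo d.dLo, max c.dHi d.dHi⟩
  | .nc, c, d => ⟨luk c.bLo d.bLo, luk c.bHi d.bHi, bsum c.dLo d.dLo, bsum c.dHi d.dHi⟩
  | .me, c, d => ⟨0, 0, bsum c.dLo d.dLo, bsum c.dHi d.dHi⟩

/-- Disjunction of confidence levels under a mode. Mutual exclusion presupposes that the
beliefs add up to at most `1`; the sum is truncated at `1`, so that the operation is total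
and agrees with plain addition whenever the presupposition holds. -/
def disj : Mode → Conf → Conf → Conf
  | .ig, c, d => ⟨max c.bLo d.bLo, bsum c.bHi d.bHi, luk c.dLo d.dLo, min c.dHi d.dHi⟩
  | .ind, c, d => ⟨psum c.bLo d.bLo, psum c.bHi d.bHi, c.dLo * d.dLo, c.dHi * d.dHi⟩
  | .pc, c, d => ⟨max c.bLo d.bLo, max c.bHi d.bHi, min c.dLo d.dLo, min c.dHi d.dHi⟩
  | .nc, c, d => ⟨bsum c.bLo d.bLo, bsum c.bHi d.bHi, luk c.dLo d.dLo, luk c.dHi d.dHi⟩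
  | .me, c, d => ⟨bsum c.bLo d.bLo, bsum c.bHi d.bHi, luk c.dLo d.dLo, luk c.dHi d.dHi⟩

/-- The truth order: more belief, less doubt. -/
instance : PartialOrder Conf where
  le c d := c.bLo ≤ d.bLo ∧ c.bHi ≤ d.bHi ∧ d.dLo ≤ c.dLo ∧ d.dHi ≤ c.dHi
  le_refl _ := ⟨le_rfl, le_rfl, le_rfl, le_rfl⟩
  le_trans _ _ _ h k := ⟨h.1.trans k.1, h.2.1.trans k.2.1, k.2.2.1.trans h.2.2.1,
    k.2.2.2.trans h.2.2.2⟩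
  le_antisymm _ _ h k := Conf.ext (le_antisymm h.1 k.1) (le_antisymm h.2.1 k.2.1)
    (le_antisymm k.2.2.1 h.2.2.1) (le_antisymm k.2.2.2 h.2.2.2)

/-- The least element `⟨[0, 0], [1, 1]⟩` of the truth order. -/
def falsum : Conf := ⟨0, 0, 1, 1⟩

/-- Some probabilities of true, false, unknown (nonnegative, of sum `1`) lie within the
bounds. -/
def Consistent (c : Conf) : Prop :=
  ∃ w₁ w₀ w : ℝ, 0 ≤ w₁ ∧ 0 ≤ w₀ ∧ 0 ≤ w ∧ w₁ + w₀ + w = 1 ∧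
    (c.bLo : ℝ) ≤ w₁ ∧ w₁ ≤ c.bHi ∧ (c.dLo : ℝ) ≤ w₀ ∧ w₀ ≤ c.dHi

end Conf

theorem luk_comm (a b : unitInterval) : luk a b = luk b a := by
  apply Subtype.ext; simp only [luk, add_comm]

theorem bsum_comm (a b : unitInterval) : bsum a b = bsum b a := by
  apply Subtype.ext; simp only [bsum, add_comm]

theorem psum_comm (a b : unitInterval) : psum a b = psum b a := by
  simp only [psum, mul_comm]

theorem luk_assoc (a b c : unitInterval) : luk (luk a b) c = luk a (luk b c) := by
  apply Subtype.ext
  have := a.2.1; have := a.2.2; have := b.2.1; have := b.2.2; have := c.2.1; have := c.2.2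
  simp only [luk]
  grind

theorem bsum_assoc (a b c : unitInterval) : bsum (bsum a b) c = bsum a (bsum b c) := by
  apply Subtype.ext
  have := a.2.1; have := a.2.2; have := b.2.1; have := b.2.2; have := c.2.1; have := c.2.2
  simp only [bsum]
  grind

theorem psum_assoc (a b c : unitInterval) : psum (psum a b) c = psum a (psum b c) := by
  simp only [psum, unitInterval.symm_symm, mul_assoc]

instance (μ : Mode) : Std.Commutative (Conf.disj μ) where
  comm c d := by
    cases μ <;>
      simp only [Conf.disj, luk_comm c.dLo, luk_comm c.dHi, bsum_comm c.bLo, bsum_comm c.bHi,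
        psum_comm c.bLo, psum_comm c.bHi, max_comm c.bLo, max_comm c.bHi, min_comm c.dLo,
        min_comm c.dHi, mul_comm c.dLo, mul_comm c.dHi]

instance (μ : Mode) : Std.Associative (Conf.disj μ) where
  assoc c d e := by
    cases μ <;>
      simp only [Conf.disj, luk_assoc, bsum_assoc, psum_assoc, max_assoc, min_assoc, mul_assoc]

/-! ### p-programs -/

/-- Terms of a function-free language: variables (indexed by `ℕ`) and constants. -/
inductive Term (Const : Type)
  | var (i : ℕ)
  | const (c : Const)

/-- Atoms with arguments in `τ`; `τ` is `Term Const`, or `Const` for ground atoms. -/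
@[ext]
structure Atom (Pred τ : Type) where
  pred : Pred
  args : List τ

/-- The p-rules: facts `A ←c`, which carry no conjunctive mode, and rules
`(A ←c B₁, …, Bₘ ; μ)` with `m ≥ 1` and conjunctive mode `μ`. The disjunctive mode of a
p-rule is that of its head predicate and is kept in the program. -/
inductive PRule (Pred τ : Type)
  | fact (head : Atom Pred τ) (c : Conf)
  | rule (head : Atom Pred τ) (c : Conf) (μ : Mode) (body : List (Atom Pred τ))

variable {Pred τ Const : Type}

namespace Term

def vars : Term Const → List ℕ
  | var i => [i]
  | const _ => []

def consts : Term Const → List Const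
  | var _ => []
  | const c => [c]

def subst (θ : ℕ → Const) : Term Const → Const
  | var i => θ i
  | const c => c

end Term

namespace Atom

def vars (A : Atom Pred (Term Const)) : List ℕ := A.args.flatMap Term.vars

def consts (A : Atom Pred (Term Const)) : List Const := A.args.flatMap Term.consts

def subst (θ : ℕ → Const) (A : Atom Pred (Term Const)) : Atom Pred Const :=
  ⟨A.pred, A.args.map (Term.subst θ)⟩

end Atom

namespace PRule

def head : PRule Pred τ → Atom Pred τ
  | fact A _ => A
  | rule A _ _ _ => A

def conf : PRule Pred τ → Conf
  | fact _ c => c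
  | rule _ c _ _ => c

def body : PRule Pred τ → List (Atom Pred τ)
  | fact _ _ => []
  | rule _ _ _ bs => bs

def IsFact : PRule Pred τ → Prop
  | fact _ _ => True
  | rule _ _ _ _ => False

def consts (r : PRule Pred (Term Const)) : List Const := (r.head :: r.body).flatMap Atom.consts

def subst (θ : ℕ → Const) : PRule Pred (Term Const) → PRule Pred Const
  | fact A c => fact (A.subst θ) c
  | rule A c μ bs => rule (A.subst θ) c μ (bs.map (Atom.subst θ))

/-- The confidence propagated to the head of a ground p-rule:
`c ∧_μ f B₁ ∧_μ ⋯ ∧_μ f Bₘ`. -/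
def ruleConf (f : Atom Pred τ → Conf) : PRule Pred τ → Conf
  | fact _ c => c
  | rule _ c μ bs => bs.foldl (fun x B => Conf.conj μ x (f B)) c

end PRule

/-- A p-program over the predicates `Pred` (with their arities) and constants taken from
`Const`: a finite set of range restricted p-rules with consistent confidence levels.
Giving one disjunctive mode per predicate says that p-rules defining the same predicate
have the same disjunctive mode. -/
structure PProgram (Pred Const : Type) (arity : Pred → ℕ) where
  rules : Finset (PRule Pred (Term Const))
  disj : Pred → Mode
  consistent : ∀ r ∈ rules, r.conf.Consistent
  arity_eq : ∀ r ∈ rules, ∀ A ∈ r.head :: r.body, A.args.length = arity A.pred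
  body_ne : ∀ r ∈ rules, r.IsFact ∨ r.body ≠ []
  range_restricted : ∀ r ∈ rules, ∀ x ∈ r.head.vars, ∃ B ∈ r.body, x ∈ B.vars

namespace PProgram

variable {arity : Pred → ℕ}

/-- The constants occurring in the program. -/
def consts [DecidableEq Const] (P : PProgram Pred Const arity) : Finset Const :=
  P.rules.biUnion fun r => r.consts.toFinset

/-- The database size: the number of constants occurring in the program. -/
def dbSize [DecidableEq Const] (P : PProgram Pred Const arity) : ℕ := P.consts.card

/-- The part of the program that is not data: its p-rules with nonempty body. -/
def properRules (P : PProgram Pred Const arity) : Finset (PRule Pred (Term Const)) := by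
  classical exact P.rules.filter fun r => ¬ r.IsFact

/-- The p-rules that are facts asserting the atom `A`. -/
def factsFor (P : PProgram Pred Const arity) (A : Atom Pred (Term Const)) :
    Finset (PRule Pred (Term Const)) := by
  classical exact P.rules.filter fun r => r.IsFact ∧ r.head = A

/-- `p` is defined by a rule whose body mentions `q`. -/
def DependsOn (P : PProgram Pred Const arity) (p q : Pred) : Prop :=
  ∃ r ∈ P.rules, r.head.pred = p ∧ ∃ B ∈ r.body, B.pred = q

/-- A predicate is recursive if it depends on itself, directly or indirectly. -/
def Recursive (P : PProgram Pred Const arity) (p : Pred) : Prop :=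
  Relation.TransGen P.DependsOn p p

section semantics

variable [DecidableEq Const] [Inhabited Const]

/-- The Herbrand universe: the constants occurring in the program, or one arbitrary
constant if there are none. -/
def herbrand (P : PProgram Pred Const arity) : Finset Const :=
  if P.consts = ∅ then {default} else P.consts

/-- The Herbrand base: the ground atoms over the Herbrand universe. -/
def base (P : PProgram Pred Const arity) : Set (Atom Pred Const) :=
  {A | A.args.length = arity A.pred ∧ ∀ c ∈ A.args, c ∈ P.herbrand}

/-- The Herbrand instantiation: the set of ground instances of the p-rules over the Herbrand
universe. -/
def ground (P : PProgram Pred Const arity) : Set (PRule Pred Const) :=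
  {g | ∃ r ∈ P.rules, ∃ θ : ℕ → Const, (∀ i, θ i ∈ P.herbrand) ∧ g = r.subst θ}

end semantics

end PProgram

theorem Atom.subst_congr {θ θ' : ℕ → Const} (A : Atom Pred (Term Const))
    (h : ∀ i ∈ A.vars, θ i = θ' i) : A.subst θ = A.subst θ' := by
  simp only [Atom.subst, Atom.mk.injEq, true_and]
  apply List.map_congr_left
  intro t ht
  cases t with
  | const c => rfl
  | var i => exact h i (List.mem_flatMap.2 ⟨_, ht, by simp [Term.vars]⟩)

theorem PRule.subst_congr {θ θ' : ℕ → Const} (r : PRule Pred (Term Const))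
    (h : ∀ A ∈ r.head :: r.body, ∀ i ∈ A.vars, θ i = θ' i) : r.subst θ = r.subst θ' := by
  cases r with
  | fact A c =>
    simp only [PRule.subst, A.subst_congr (h A (by simp [PRule.head]))]
  | rule A c μ bs =>
    simp only [PRule.subst, A.subst_congr (h A (by simp [PRule.head]))]
    congr 1
    apply List.map_congr_left
    intro B hB
    exact B.subst_congr (h B (by simp [PRule.body, hB]))

theorem PProgram.ground_finite {arity : Pred → ℕ} [DecidableEq Const] [Inhabited Const]
    (P : PProgram Pred Const arity) : P.ground.Finite := by
  have hne : P.herbrand.Nonempty := by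
    unfold PProgram.herbrand
    split_ifs with h
    · simp
    · exact Finset.nonempty_iff_ne_empty.2 h
  obtain ⟨a, ha⟩ := hne
  have key : ∀ r ∈ P.rules,
      {g | ∃ θ : ℕ → Const, (∀ i, θ i ∈ P.herbrand) ∧ g = PRule.subst θ r}.Finite := by
    intro r _
    obtain ⟨N, hN⟩ : ∃ N, ∀ A ∈ r.head :: r.body, ∀ i ∈ A.vars, i < N := by
      refine ⟨((r.head :: r.body).flatMap Atom.vars).sum + 1, fun A hA i hi => ?_⟩
      exact Nat.lt_succ_of_le (List.le_sum_of_mem (List.mem_flatMap.2 ⟨A, hA, hi⟩))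
    refine (Set.finite_range (fun t : Fin N → P.herbrand =>
      r.subst (fun i => if h : i < N then (t ⟨i, h⟩ : Const) else a))).subset ?_
    rintro g ⟨θ, hθ, rfl⟩
    refine ⟨fun i => ⟨θ i, hθ i⟩, ?_⟩
    apply PRule.subst_congr
    intro A hA i hi
    simp [hN A hA i hi]
  refine (P.rules.finite_toSet.biUnion key).subset ?_
  rintro g ⟨r, hr, θ, hθ, rfl⟩
  simp only [Set.mem_iUnion]
  exact ⟨r, hr, θ, hθ, rfl⟩

namespace PProgram

variable {arity : Pred → ℕ} [DecidableEq Const] [Inhabited Const]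

/-- Valuations, ordered pointwise by the truth order. -/
abbrev Valuation (P : PProgram Pred Const arity) : Type := P.base → Conf

/-- The valuation **false**. -/
def falseVal (P : PProgram Pred Const arity) : P.Valuation := fun _ => Conf.falsum

/-- The value of a valuation at a ground atom (atoms outside the Herbrand base, which do not
occur in the Herbrand instantiation, get the least value). -/
def value (P : PProgram Pred Const arity) (v : P.Valuation) (A : Atom Pred Const) : Conf := by
  classical exact if h : A ∈ P.base then v ⟨A, h⟩ else Conf.falsum

/-- The immediate consequence operator: the disjunction, in the mode of the predicate of `A`,
of the confidences propagated to `A` by the ground p-rules with head `A`. The least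
confidence level is the identity of every disjunction and the value of the empty one. -/
def immCons (P : PProgram Pred Const arity) (v : P.Valuation) : P.Valuation := by
  classical
  exact fun A =>
    (P.ground_finite.toFinset.filter fun g => g.head = A.1).fold
      (Conf.disj (P.disj A.1.pred)) Conf.falsum (PRule.ruleConf (P.value v))

end PProgram

/-! ### Unit-cost computations

The cost model: lists are linked lists; a test of equality of two symbols, a comparison of
two numbers, an arithmetic operation on two real numbers, and every visit of a list cell
cost one unit each. Each function below charges its own operations, once per recursive
call, and calls no function of unbounded cost that does not itself charge. -/

/-- The result of a computation together with the number of elementary operations used. -/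
structure Timed (α : Type) where
  val : α
  time : ℕ

namespace Timed

instance : Monad Timed where
  pure a := ⟨a, 0⟩
  bind x f := ⟨(f x.val).val, x.time + (f x.val).time⟩

/-- Charge `n` elementary operations. -/
def tick (n : ℕ) : Timed Unit := ⟨(), n⟩

end Timed

namespace Naive

open Timed

variable {α β : Type}

def append : List α → List α → Timed (List α)
  | [], k => do tick 1; return k
  | a :: l, k => do tick 1; let r ← append l k; return a :: r

def map (f : α → Timed β) : List α → Timed (List β)
  | [] => do tick 1; return []
  | a :: l => do tick 1; let b ← f a; let r ← map f l; return b :: r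

def flatMap (f : α → Timed (List β)) : List α → Timed (List β)
  | [] => do tick 1; return []
  | a :: l => do tick 1; let b ← f a; let r ← flatMap f l; append b r

/-- The `i`-th entry of a list. -/
def get (d : α) : List α → ℕ → Timed α
  | [], _ => do tick 1; return d
  | a :: _, 0 => do tick 1; return a
  | _ :: l, i + 1 => do tick 1; get d l i

/-- Equality of two symbols. -/
def symEq [DecidableEq α] (a b : α) : Timed Bool := do tick 1; return decide (a = b)

def listEq (eq : α → α → Timed Bool) : List α → List α → Timed Bool
  | [], [] => do tick 1; return true
  | a :: l, b :: k => do
    tick 1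
    let e ← eq a b
    if e then listEq eq l k else return false
  | _, _ => do tick 1; return false

def mem (eq : α → α → Timed Bool) (a : α) : List α → Timed Bool
  | [] => do tick 1; return false
  | b :: l => do
    tick 1
    let e ← eq a b
    if e then return true else mem eq a l

/-- Removal of repetitions. -/
def dedup (eq : α → α → Timed Bool) : List α → Timed (List α)
  | [] => do tick 1; return []
  | a :: l => do
    tick 1
    let r ← dedup eq l
    let e ← mem eq a r
    if e then return r else return a :: r

/-- All lists of length `k` with entries in a given list. -/
def tuples (cs : List α) : ℕ → Timed (List (List α))
  | 0 => do tick 1; return [[]]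
  | k + 1 => do
    tick 1
    let ts ← tuples cs k
    flatMap (fun c => map (fun t => do tick 1; return c :: t) ts) cs

/-- Four comparisons of real numbers. -/
def confEq (c d : Conf) : Timed Bool := by
  classical exact do tick 4; return decide (c = d)

/-- Each of the four bounds takes at most four operations on real numbers. -/
def conj (μ : Mode) (c d : Conf) : Timed Conf := do tick 16; return Conf.conj μ c d

/-- Each of the four bounds takes at most four operations on real numbers. -/
def disj (μ : Mode) (c d : Conf) : Timed Conf := do tick 16; return Conf.disj μ c d

def modeEq (μ ν : Mode) : Timed Bool := by
  classical exact do tick 1; return decide (μ = ν)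

section

variable [DecidableEq Pred] [DecidableEq Const]

def atomEq (A B : Atom Pred Const) : Timed Bool := do
  let e ← symEq A.pred B.pred
  if e then listEq symEq A.args B.args else return false

def ruleEq : PRule Pred Const → PRule Pred Const → Timed Bool
  | .fact A c, .fact B d => do
    tick 1
    let e ← atomEq A B
    if e then confEq c d else return false
  | .rule A c μ as, .rule B d ν bs => do
    tick 1
    let e ← atomEq A B
    let e₁ ← confEq c d
    let e₂ ← modeEq μ ν
    let e₃ ← listEq atomEq as bs
    return e && e₁ && e₂ && e₃
  | _, _ => do tick 1; return false

end

/-! #### Grounding -/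

def atomConsts (A : Atom Pred (Term Const)) : Timed (List Const) :=
  flatMap (fun t => do tick 1; return t.consts) A.args

def ruleConsts (r : PRule Pred (Term Const)) : Timed (List Const) := do
  tick 1
  flatMap atomConsts (r.head :: r.body)

def termVars (t : Term Const) : Timed (List ℕ) := do tick 1; return t.vars

def ruleVars (r : PRule Pred (Term Const)) : Timed (List ℕ) := do
  tick 1
  flatMap (fun A => flatMap termVars A.args) (r.head :: r.body)

/-- A strict upper bound of a list of numbers. -/
def bound : List ℕ → Timed ℕ
  | [] => do tick 1; return 0
  | i :: l => do tick 1; let b ← bound l; return max (i + 1) b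

def termSubst [Inhabited Const] (θ : List Const) : Term Const → Timed Const
  | .var i => do tick 1; get default θ i
  | .const c => do tick 1; return c

def atomSubst [Inhabited Const] (θ : List Const) (A : Atom Pred (Term Const)) :
    Timed (Atom Pred Const) := do
  tick 1
  let as ← map (termSubst θ) A.args
  return ⟨A.pred, as⟩

def ruleSubst [Inhabited Const] (θ : List Const) :
    PRule Pred (Term Const) → Timed (PRule Pred Const)
  | .fact A c => do
    tick 1
    let A' ← atomSubst θ A
    return .fact A' c
  | .rule A c μ bs => do
    tick 1
    let A' ← atomSubst θ A
    let bs' ← map (atomSubst θ) bs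
    return .rule A' c μ bs'

/-- The instances of a rule over a list of constants. -/
def instances [Inhabited Const] (cs : List Const) (r : PRule Pred (Term Const)) :
    Timed (List (PRule Pred Const)) := do
  let xs ← ruleVars r
  let k ← bound xs
  let θs ← tuples cs k
  map (fun θ => ruleSubst θ r) θs

/-- A valuation as a table: one entry per ground atom. -/
abbrev Table (Pred Const : Type) : Type := List (Atom Pred Const × Conf)

/-- The set-up phase: collect the constants, instantiate the p-rules, and build the table
of the valuation **false**. -/
def setup [DecidableEq Pred] [DecidableEq Const] [Inhabited Const] (arity : Pred → ℕ)
    (preds : List Pred) (rules : List (PRule Pred (Term Const))) :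
    Timed (List (PRule Pred Const) × Table Pred Const) := do
  let cs ← flatMap ruleConsts rules
  let cs' ← dedup symEq cs
  tick 1
  let univ := match cs' with
    | [] => [default]
    | c :: l => c :: l
  let gs ← flatMap (instances univ) rules
  let gs' ← dedup ruleEq gs
  let tab ← flatMap (fun p => do
    tick 1
    let ts ← tuples univ (arity p)
    map (fun t => do tick 1; return ((⟨p, t⟩ : Atom Pred Const), Conf.falsum)) ts) preds
  return (gs', tab)

/-! #### Iteration -/

section

variable [DecidableEq Pred] [DecidableEq Const]

def lookup (A : Atom Pred Const) : Table Pred Const → Timed Conf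
  | [] => do tick 1; return Conf.falsum
  | (B, c) :: tab => do
    tick 1
    let e ← atomEq A B
    if e then return c else lookup A tab

def bodyConf (tab : Table Pred Const) (μ : Mode) : Conf → List (Atom Pred Const) → Timed Conf
  | x, [] => do tick 1; return x
  | x, B :: bs => do
    tick 1
    let c ← lookup B tab
    let y ← conj μ x c
    bodyConf tab μ y bs

def ruleConf (tab : Table Pred Const) : PRule Pred Const → Timed Conf
  | .fact _ c => do tick 1; return c
  | .rule _ c μ bs => do tick 1; bodyConf tab μ c bs

/-- Combine the confidences of all derivations of `A`. -/
def atomConf (μ : Mode) (tab : Table Pred Const) (A : Atom Pred Const) :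
    List (PRule Pred Const) → Timed Conf
  | [] => do tick 1; return Conf.falsum
  | g :: gs => do
    tick 1
    let x ← atomConf μ tab A gs
    let e ← atomEq g.head A
    if e then
      let c ← ruleConf tab g
      disj μ c x
    else return x

/-- One iteration: recompute every entry from the previous table, and test whether anything
has changed. -/
def iteration (modes : Pred → Mode) (gs : List (PRule Pred Const)) (tab : Table Pred Const) :
    Timed (Table Pred Const × Bool) := do
  let tab' ← map (fun e => do
    tick 1
    let c ← atomConf (modes e.1.pred) tab e.1 gs
    return (e.1, c)) tab
  let same ← listEq (fun e e' => confEq e.2 e'.2) tab tab'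
  return (tab', same)

/-- `Loop modes gs tab costs out`: iterating from `tab` until nothing changes halts with the
table `out`; `costs` lists the numbers of elementary operations of the successive
iterations, the last of which verifies that nothing has changed. -/
inductive Loop (modes : Pred → Mode) (gs : List (PRule Pred Const)) :
    Table Pred Const → List ℕ → Table Pred Const → Prop
  | halt (tab : Table Pred Const) (h : (iteration modes gs tab).val.2 = true) :
      Loop modes gs tab [(iteration modes gs tab).time] (iteration modes gs tab).val.1
  | next (tab : Table Pred Const) (costs : List ℕ) (out : Table Pred Const)
      (h : (iteration modes gs tab).val.2 = false)
      (h' : Loop modes gs (iteration modes gs tab).val.1 costs out) :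
      Loop modes gs tab ((iteration modes gs tab).time :: costs) out

/-- Naive bottom-up evaluation of the listed program halts after `costs.length` iterations
with the table `out`, using `s` elementary operations for the set-up and `costs` for the
iterations. -/
def Halts [Inhabited Const] (arity : Pred → ℕ) (modes : Pred → Mode) (preds : List Pred)
    (rules : List (PRule Pred (Term Const))) (s : ℕ) (costs : List ℕ)
    (out : Table Pred Const) : Prop :=
  s = (setup arity preds rules).time ∧
    Loop modes (setup arity preds rules).val.1 (setup arity preds rules).val.2 costs out

end

end Naive

end PDatalog

end

/-! ### Monotonicity and bounds of the operations on the unit interval -/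

namespace PDatalog

/-! All connectives are monotone, so the stages `T_P^k(⊥)` increase and lie below every fixpoint. It
therefore suffices to show that the stage whose index is the number N of ground atoms is a fixpoint
(`PProgram.stage_card_base`). Monotonicity alone does not give this, since the truth order has
infinite increasing sequences.

The argument treats the four bounds separately, negating the doubt bounds so that each becomes a
monotone real coordinate (`Conf.IsCoord`) on which positively correlated disjunction is a maximum.
If a coordinate of an atom changes at one stage, some body atom of a rule for it changed one stage
earlier (`exists_change_of_change`). If the head's mode is positive correlation, the new value is
attained by a single ground rule whose value has just increased. A conjunction lies below each
conjunct, so the body atom is at least as large as the head.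

A change from stage N to stage N + 1 can thus be traced back through N + 1 atoms (`exists_chain`),
and two of these coincide by pigeonhole. The predicates between the two occurrences lie on a
dependency cycle, hence are recursive, hence use positive correlation. So the value that the
repeated atom takes at its later change is at most the one it had at its earlier change, and the
later change is no change at all: a contradiction.

The rest is accounting. The fixed rules and arities bound rule size and variable indices by a
constant w, and range restriction makes the facts ground. All lists built by the algorithm then have
length polynomial in the number of constants, with exponents depending on w only. The tables of
successive iterations are the tables of successive stages (`Naive.val_iteration`), so at most N + 1
iterations of polynomial cost occur. -/

theorem luk_mono {a a' b b' : unitInterval} (h : a ≤ a') (k : b ≤ b') : luk a b ≤ luk a' b' := by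
  have h' : (a : ℝ) ≤ a' := h
  have k' : (b : ℝ) ≤ b' := k
  exact max_le_max le_rfl (show (a : ℝ) + b - 1 ≤ a' + b' - 1 by linarith)

theorem bsum_mono {a a' b b' : unitInterval} (h : a ≤ a') (k : b ≤ b') :
    bsum a b ≤ bsum a' b' := by
  have h' : (a : ℝ) ≤ a' := h
  have k' : (b : ℝ) ≤ b' := k
  exact min_le_min le_rfl (show (a : ℝ) + b ≤ a' + b' by linarith)

theorem psum_mono {a a' b b' : unitInterval} (h : a ≤ a') (k : b ≤ b') :
    psum a b ≤ psum a' b' := by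
  have h' : (a : ℝ) ≤ a' := h
  have k' : (b : ℝ) ≤ b' := k
  apply Subtype.coe_le_coe.1
  simp only [psum, unitInterval.coe_symm_eq, Set.Icc.coe_mul]
  have := a'.2.2; have := b.2.2
  nlinarith

theorem luk_le_left (a b : unitInterval) : luk a b ≤ a := by
  have := a.2.1; have := b.2.2
  exact max_le a.2.1 (by linarith)

theorem luk_le_right (a b : unitInterval) : luk a b ≤ b := luk_comm a b ▸ luk_le_left b a

theorem le_bsum_left (a b : unitInterval) : a ≤ bsum a b := by
  have := b.2.1
  exact le_min a.2.2 (by linarith)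

theorem le_bsum_right (a b : unitInterval) : b ≤ bsum a b := bsum_comm a b ▸ le_bsum_left b a

theorem le_psum_left (a b : unitInterval) : a ≤ psum a b := by
  apply Subtype.coe_le_coe.1
  simp only [psum, unitInterval.coe_symm_eq, Set.Icc.coe_mul]
  have := a.2.2; have := b.2.1
  nlinarith

theorem le_psum_right (a b : unitInterval) : b ≤ psum a b := psum_comm a b ▸ le_psum_left b a

theorem unitInterval_mul_mono {a a' b b' : unitInterval} (h : a ≤ a') (k : b ≤ b') :
    a * b ≤ a' * b' := by
  have h' : (a : ℝ) ≤ a' := h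
  have k' : (b : ℝ) ≤ b' := k
  apply Subtype.coe_le_coe.1
  simp only [Set.Icc.coe_mul]
  have := a'.2.1; have := b.2.1
  nlinarith

/-! ### Order properties of the connectives and the four real coordinates -/

namespace Conf

theorem falsum_le (c : Conf) : falsum ≤ c :=
  ⟨c.bLo.2.1, c.bHi.2.1, c.dLo.2.2, c.dHi.2.2⟩

theorem conj_mono (μ : Mode) {c c' d d' : Conf} (h : c ≤ c') (k : d ≤ d') :
    conj μ c d ≤ conj μ c' d' := by
  obtain ⟨h₁, h₂, h₃, h₄⟩ := h
  obtain ⟨k₁, k₂, k₃, k₄⟩ := k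
  cases μ <;> refine ⟨?_, ?_, ?_, ?_⟩ <;>
    first
    | exact le_rfl
    | (apply luk_mono <;> assumption)
    | (apply bsum_mono <;> assumption)
    | (apply psum_mono <;> assumption)
    | (apply unitInterval_mul_mono <;> assumption)
    | (apply min_le_min <;> assumption)
    | (apply max_le_max <;> assumption)

theorem disj_mono (μ : Mode) {c c' d d' : Conf} (h : c ≤ c') (k : d ≤ d') :
    disj μ c d ≤ disj μ c' d' := by
  obtain ⟨h₁, h₂, h₃, h₄⟩ := h
  obtain ⟨k₁, k₂, k₃, k₄⟩ := k
  cases μ <;> refine ⟨?_, ?_, ?_, ?_⟩ <;>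
    first
    | (apply luk_mono <;> assumption)
    | (apply bsum_mono <;> assumption)
    | (apply psum_mono <;> assumption)
    | (apply unitInterval_mul_mono <;> assumption)
    | (apply min_le_min <;> assumption)
    | (apply max_le_max <;> assumption)

/-- A real coordinate of confidence levels on which all connectives act separately. -/
structure IsCoord (π : Conf → ℝ) : Prop where
  mono : Monotone π
  conj_congr : ∀ μ c c' d d', π c = π c' → π d = π d' → π (conj μ c d) = π (conj μ c' d')
  disj_congr : ∀ μ c c' d d', π c = π c' → π d = π d' → π (disj μ c d) = π (disj μ c' d')
  disj_pc : ∀ c d, π (disj .pc c d) = max (π c) (π d)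

/-- In every mode a belief bound of a conjunction is at most, and a doubt bound at least, that of
either conjunct. This is what keeps values from growing around a dependency cycle. -/
theorem conj_le_left (μ : Mode) (c d : Conf) : conj μ c d ≤ c := by
  cases μ <;> refine ⟨?_, ?_, ?_, ?_⟩ <;>
    first
    | exact unitInterval.nonneg'
    | exact luk_le_left _ _
    | exact le_bsum_left _ _
    | exact le_psum_left _ _
    | exact unitInterval.mul_le_left
    | exact min_le_left _ _
    | exact le_max_left _ _

theorem conj_le_right (μ : Mode) (c d : Conf) : conj μ c d ≤ d := by
  cases μ <;> refine ⟨?_, ?_, ?_, ?_⟩ <;>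
    first
    | exact unitInterval.nonneg'
    | exact luk_le_right _ _
    | exact le_bsum_right _ _
    | exact le_psum_right _ _
    | exact unitInterval.mul_le_right
    | exact min_le_right _ _
    | exact le_max_right _ _

theorem isCoord_bLo : IsCoord fun c => c.bLo where
  mono _ _ h := h.1
  conj_congr μ c c' d d' h k := by
    simp only [Subtype.coe_inj] at h k ⊢
    cases μ <;> simp only [conj, h, k]
  disj_congr μ c c' d d' h k := by
    simp only [Subtype.coe_inj] at h k ⊢
    cases μ <;> simp only [disj, h, k]
  disj_pc c d := (Subtype.mono_coe _).map_max

theorem isCoord_bHi : IsCoord fun c => c.bHi where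
  mono _ _ h := h.2.1
  conj_congr μ c c' d d' h k := by
    simp only [Subtype.coe_inj] at h k ⊢
    cases μ <;> simp only [conj, h, k]
  disj_congr μ c c' d d' h k := by
    simp only [Subtype.coe_inj] at h k ⊢
    cases μ <;> simp only [disj, h, k]
  disj_pc c d := (Subtype.mono_coe _).map_max

/-- The truth order reverses doubt; the sign makes the coordinate monotone and turns the minimum of
positive correlation into a maximum. -/
theorem isCoord_neg_dLo : IsCoord fun c => -c.dLo where
  mono _ _ h := neg_le_neg h.2.2.1
  conj_congr μ c c' d d' h k := by
    simp only [neg_inj, Subtype.coe_inj] at h k ⊢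
    cases μ <;> simp only [conj, h, k]
  disj_congr μ c c' d d' h k := by
    simp only [neg_inj, Subtype.coe_inj] at h k ⊢
    cases μ <;> simp only [disj, h, k]
  disj_pc c d := by
    rw [max_neg_neg]; exact congrArg _ (Subtype.mono_coe _).map_min

theorem isCoord_neg_dHi : IsCoord fun c => -c.dHi where
  mono _ _ h := neg_le_neg h.2.2.2
  conj_congr μ c c' d d' h k := by
    simp only [neg_inj, Subtype.coe_inj] at h k ⊢
    cases μ <;> simp only [conj, h, k]
  disj_congr μ c c' d d' h k := by
    simp only [neg_inj, Subtype.coe_inj] at h k ⊢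
    cases μ <;> simp only [disj, h, k]
  disj_pc c d := by
    rw [max_neg_neg]; exact congrArg _ (Subtype.mono_coe _).map_min

/-- Allows the fixpoint equation to be checked one bound at a time. This matters because the ground
rule attaining a maximum may differ from one bound to another. -/
theorem eq_of_coord {c d : Conf} (h : ∀ π, IsCoord π → π c = π d) : c = d :=
  Conf.ext (Subtype.ext (h _ isCoord_bLo)) (Subtype.ext (h _ isCoord_bHi))
    (Subtype.ext (neg_injective (h _ isCoord_neg_dLo)))
    (Subtype.ext (neg_injective (h _ isCoord_neg_dHi)))

section fold

variable {α : Type} (s : Finset α) (μ : Mode) (f g : α → Conf)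

theorem fold_disj_mono (h : ∀ a ∈ s, f a ≤ g a) :
    s.fold (disj μ) falsum f ≤ s.fold (disj μ) falsum g := by
  classical
  induction s using Finset.induction_on with
  | empty => simp
  | insert a s ha ih =>
    rw [Finset.fold_insert ha, Finset.fold_insert ha]
    exact disj_mono _ (h a (by simp)) (ih fun b hb => h b (by simp [hb]))

theorem IsCoord.fold_disj_congr {π : Conf → ℝ} (hπ : IsCoord π) (h : ∀ a ∈ s, π (f a) = π (g a)) :
    π (s.fold (disj μ) falsum f) = π (s.fold (disj μ) falsum g) := by
  classical
  induction s using Finset.induction_on with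
  | empty => simp
  | insert a s ha ih =>
    rw [Finset.fold_insert ha, Finset.fold_insert ha]
    exact hπ.disj_congr _ _ _ _ _ (h a (by simp)) (ih fun b hb => h b (by simp [hb]))

theorem IsCoord.le_fold_pc {π : Conf → ℝ} (hπ : IsCoord π) {a : α} (ha : a ∈ s) :
    π (f a) ≤ π (s.fold (disj .pc) falsum f) := by
  classical
  induction s using Finset.induction_on with
  | empty => simp at ha
  | insert b s hb ih =>
    rw [Finset.fold_insert hb, hπ.disj_pc]
    rcases Finset.mem_insert.1 ha with rfl | h
    · exact le_max_left _ _
    · exact (ih h).trans (le_max_right _ _)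

/-- In such a coordinate the fold is the maximum of the summands and the initial value; strictness
rules out that only the initial value attains it. -/
theorem IsCoord.exists_fold_pc {π : Conf → ℝ} (hπ : IsCoord π)
    (h : π falsum < π (s.fold (disj .pc) falsum f)) :
    ∃ a ∈ s, π (s.fold (disj .pc) falsum f) = π (f a) := by
  classical
  induction s using Finset.induction_on with
  | empty => simp at h
  | insert b s hb ih =>
    rw [Finset.fold_insert hb, hπ.disj_pc] at h ⊢
    rcases le_total (π (s.fold (disj .pc) falsum f)) (π (f b)) with hle | hle
    · exact ⟨b, by simp, max_eq_left hle⟩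
    · rw [max_eq_right hle] at h ⊢
      obtain ⟨a, ha, e⟩ := ih h
      exact ⟨a, by simp [ha], e⟩

end fold

end Conf

/-! ### Confidence propagated by a single ground rule -/

namespace PRule

variable {Pred τ : Type}

theorem foldl_conj_mono (μ : Mode) {f g : Atom Pred τ → Conf} (h : ∀ A, f A ≤ g A)
    (bs : List (Atom Pred τ)) {c d : Conf} (hcd : c ≤ d) :
    bs.foldl (fun x B => Conf.conj μ x (f B)) c ≤ bs.foldl (fun x B => Conf.conj μ x (g B)) d := by
  induction bs generalizing c d with
  | nil => exact hcd
  | cons B bs ih => exact ih (Conf.conj_mono μ hcd (h B))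

theorem foldl_conj_le (μ : Mode) (f : Atom Pred τ → Conf) (bs : List (Atom Pred τ)) (c : Conf) :
    bs.foldl (fun x B => Conf.conj μ x (f B)) c ≤ c := by
  induction bs generalizing c with
  | nil => exact le_rfl
  | cons B bs ih => exact (ih _).trans (Conf.conj_le_left _ _ _)

theorem foldl_conj_le_of_mem (μ : Mode) (f : Atom Pred τ → Conf) (bs : List (Atom Pred τ))
    (c : Conf) {B : Atom Pred τ} (hB : B ∈ bs) :
    bs.foldl (fun x B => Conf.conj μ x (f B)) c ≤ f B := by
  induction bs generalizing c with
  | nil => simp at hB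
  | cons B' bs ih =>
    rcases List.mem_cons.1 hB with rfl | h
    · exact (foldl_conj_le μ f bs _).trans (Conf.conj_le_right _ _ _)
    · exact ih _ h

theorem foldl_conj_congr {π : Conf → ℝ} (hπ : Conf.IsCoord π) (μ : Mode)
    {f g : Atom Pred τ → Conf} (bs : List (Atom Pred τ)) (h : ∀ B ∈ bs, π (f B) = π (g B))
    {c d : Conf} (hcd : π c = π d) :
    π (bs.foldl (fun x B => Conf.conj μ x (f B)) c) =
      π (bs.foldl (fun x B => Conf.conj μ x (g B)) d) := by
  induction bs generalizing c d with
  | nil => exact hcd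
  | cons B bs ih =>
    exact ih (fun B' h' => h B' (by simp [h'])) (hπ.conj_congr _ _ _ _ _ hcd (h B (by simp)))

theorem ruleConf_mono {f g : Atom Pred τ → Conf} (h : ∀ A, f A ≤ g A) (r : PRule Pred τ) :
    r.ruleConf f ≤ r.ruleConf g := by
  cases r with
  | fact A c => exact le_rfl
  | rule A c μ bs => exact foldl_conj_mono μ h bs le_rfl

theorem ruleConf_le_of_mem (f : Atom Pred τ → Conf) (r : PRule Pred τ) {B : Atom Pred τ}
    (hB : B ∈ r.body) : r.ruleConf f ≤ f B := by
  cases r with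
  | fact A c => simp [body] at hB
  | rule A c μ bs => exact foldl_conj_le_of_mem μ f bs c hB

theorem exists_mem_body_of_ruleConf_ne {π : Conf → ℝ} (hπ : Conf.IsCoord π)
    {f g : Atom Pred τ → Conf} (r : PRule Pred τ) (h : π (r.ruleConf f) ≠ π (r.ruleConf g)) :
    ∃ B ∈ r.body, π (f B) ≠ π (g B) := by
  contrapose! h
  cases r with
  | fact A c => rfl
  | rule A c μ bs => exact foldl_conj_congr hπ μ bs h rfl

end PRule

/-! ### Stages of the operator and the bound on their number -/

namespace PProgram

variable {Pred Const : Type} {arity : Pred → ℕ} [DecidableEq Const] [Inhabited Const]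
  (P : PProgram Pred Const arity)

theorem value_of_mem {v : P.Valuation} {A : Atom Pred Const} (h : A ∈ P.base) :
    P.value v A = v ⟨A, h⟩ := by
  simp only [value, dif_pos h]

theorem value_of_notMem {v : P.Valuation} {A : Atom Pred Const} (h : A ∉ P.base) :
    P.value v A = Conf.falsum := by
  simp only [value, dif_neg h]

theorem value_mono {v w : P.Valuation} (h : v ≤ w) (A : Atom Pred Const) :
    P.value v A ≤ P.value w A := by
  by_cases hA : A ∈ P.base
  · rw [P.value_of_mem hA, P.value_of_mem hA]; exact h _
  · rw [P.value_of_notMem hA, P.value_of_notMem hA]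

theorem immCons_mono : Monotone P.immCons := fun _ _ h _ =>
  Conf.fold_disj_mono _ _ _ _ fun g _ => g.ruleConf_mono (P.value_mono h)

theorem falseVal_le (v : P.Valuation) : P.falseVal ≤ v := fun _ => Conf.falsum_le _

/-- The stages of naive evaluation. -/
noncomputable def stage (k : ℕ) : P.Valuation := P.immCons^[k] P.falseVal

theorem stage_succ (k : ℕ) : P.stage (k + 1) = P.immCons (P.stage k) :=
  Function.iterate_succ_apply' _ _ _

theorem stage_mono : Monotone P.stage :=
  P.immCons_mono.monotone_iterate_of_le_map (P.falseVal_le _)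

theorem stage_le_of_fixed {v : P.Valuation} (h : P.immCons v = v) (k : ℕ) : P.stage k ≤ v := by
  induction k with
  | zero => exact P.falseVal_le v
  | succ k ih => rw [stage_succ, ← h]; exact P.immCons_mono ih

theorem isLeast_stage {k : ℕ} (h : P.stage (k + 1) = P.stage k) :
    IsLeast {u | P.immCons u = u} (P.stage k) :=
  ⟨by rw [Set.mem_ofPred_eq, ← stage_succ, h], fun _ hv => P.stage_le_of_fixed hv k⟩

theorem body_subst {τ : Type} (θ : ℕ → τ) (r : PRule Pred (Term τ)) :
    (r.subst θ).body = r.body.map (Atom.subst θ) := by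
  cases r <;> rfl

theorem head_subst {τ : Type} (θ : ℕ → τ) (r : PRule Pred (Term τ)) :
    (r.subst θ).head = r.head.subst θ := by
  cases r <;> rfl

theorem dependsOn_of_mem_ground {g : PRule Pred Const} (hg : g ∈ P.ground) {B : Atom Pred Const}
    (hB : B ∈ g.body) : P.DependsOn g.head.pred B.pred := by
  obtain ⟨r, hr, θ, -, rfl⟩ := hg
  rw [body_subst] at hB
  obtain ⟨B', hB', rfl⟩ := List.mem_map.1 hB
  exact ⟨r, hr, by rw [head_subst]; rfl, B', hB', rfl⟩

/-- The stage at which the coordinate `π` of an atom changes is explained by a change, one stage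
earlier, of an atom it depends on; under positive correlation the latter has no smaller value. -/
theorem exists_change_of_change {π : Conf → ℝ} (hπ : Conf.IsCoord π) {k : ℕ} {A : P.base}
    (h : π (P.stage (k + 2) A) ≠ π (P.stage (k + 1) A)) :
    ∃ B : P.base, P.DependsOn A.1.pred B.1.pred ∧
      π (P.stage (k + 1) B) ≠ π (P.stage k B) ∧
      (P.disj A.1.pred = .pc → π (P.stage (k + 2) A) ≤ π (P.stage (k + 1) B)) := by
  classical
  -- A ground rule whose value changes has a changed body atom. That atom lies in the base, because
  -- values outside it are constant, and it bounds the value of the rule.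
  have key : ∀ g ∈ P.ground, g.head = A.1 →
      π (g.ruleConf (P.value (P.stage (k + 1)))) ≠ π (g.ruleConf (P.value (P.stage k))) →
      ∃ B : P.base, P.DependsOn A.1.pred B.1.pred ∧
        π (P.stage (k + 1) B) ≠ π (P.stage k B) ∧
        π (g.ruleConf (P.value (P.stage (k + 1)))) ≤ π (P.stage (k + 1) B) := by
    intro g hg hA hne
    obtain ⟨B, hB, hBne⟩ := g.exists_mem_body_of_ruleConf_ne hπ hne
    have hBb : B ∈ P.base := by
      by_contra hn
      exact hBne (by rw [P.value_of_notMem hn, P.value_of_notMem hn])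
    have hle := hπ.mono (g.ruleConf_le_of_mem (P.value (P.stage (k + 1))) hB)
    rw [P.value_of_mem hBb] at hle
    rw [P.value_of_mem hBb, P.value_of_mem hBb] at hBne
    exact ⟨⟨B, hBb⟩, hA ▸ P.dependsOn_of_mem_ground hg hB, hBne, hle⟩
  have hmem : ∀ g, g ∈ (P.ground_finite.toFinset.filter fun g => g.head = A.1) →
      g ∈ P.ground ∧ g.head = A.1 := by simp
  by_cases hpc : P.disj A.1.pred = .pc
  -- Under positive correlation the new value is attained by some rule `g`. One stage earlier `g`
  -- contributed at most the old value, which is strictly smaller, so `g` itself has changed.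
  · have hlt : π (P.stage (k + 1) A) < π (P.stage (k + 2) A) :=
      lt_of_le_of_ne (hπ.mono (P.stage_mono (Nat.le_succ _) A)) h.symm
    have e₂ := congrFun (P.stage_succ (k + 1)) A
    have e₁ := congrFun (P.stage_succ k) A
    simp only [immCons, hpc] at e₁ e₂
    obtain ⟨g, hg, hgeq⟩ := hπ.exists_fold_pc (P.ground_finite.toFinset.filter fun g => g.head = A.1)
      (PRule.ruleConf (P.value (P.stage (k + 1))))
      (by rw [← e₂]; exact (hπ.mono (Conf.falsum_le _)).trans_lt hlt)
    rw [← e₂] at hgeq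
    have hle := hπ.le_fold_pc _ (PRule.ruleConf (P.value (P.stage k))) hg
    rw [← e₁] at hle
    obtain ⟨B, h₁, h₂, h₃⟩ := key g (hmem g hg).1 (hmem g hg).2
      (by rw [← hgeq]; exact (hle.trans_lt hlt).ne')
    exact ⟨B, h₁, h₂, fun _ => hgeq.le.trans h₃⟩
  -- For the other modes it is enough that an unchanged coordinate of every rule value leaves the
  -- disjunction unchanged.
  · by_contra hcon
    apply h
    have e₂ := congrFun (P.stage_succ (k + 1)) A
    have e₁ := congrFun (P.stage_succ k) A
    rw [e₂, e₁]
    apply hπ.fold_disj_congr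
    intro g hg
    by_contra hne
    obtain ⟨B, h₁, h₂, -⟩ := key g (hmem g hg).1 (hmem g hg).2 hne
    exact hcon ⟨B, h₁, h₂, fun h => absurd h hpc⟩

/-- Iterates the previous step down to stage 0. The atom with index j changes between stages j and j
+ 1; entries beyond k are irrelevant. -/
theorem exists_chain {π : Conf → ℝ} (hπ : Conf.IsCoord π) (k : ℕ) (A : P.base)
    (h : π (P.stage (k + 1) A) ≠ π (P.stage k A)) :
    ∃ a : ℕ → P.base, a k = A ∧ (∀ j ≤ k, π (P.stage (j + 1) (a j)) ≠ π (P.stage j (a j))) ∧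
      ∀ j < k, P.DependsOn (a (j + 1)).1.pred (a j).1.pred ∧
        (P.disj (a (j + 1)).1.pred = .pc →
          π (P.stage (j + 2) (a (j + 1))) ≤ π (P.stage (j + 1) (a j))) := by
  induction k generalizing A with
  | zero => exact ⟨fun _ => A, rfl, fun j hj => by obtain rfl := Nat.le_zero.1 hj; exact h,
      fun j hj => absurd hj (Nat.not_lt_zero j)⟩
  | succ k ih =>
    obtain ⟨B, h₁, h₂, h₃⟩ := P.exists_change_of_change hπ h
    obtain ⟨a, rfl, ha, hd⟩ := ih B h₂
    refine ⟨fun j => if j = k + 1 then A else a j, if_pos rfl, fun j hj => ?_, fun j hj => ?_⟩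
    · by_cases hjk : j = k + 1
      · subst hjk; simpa using h
      · simpa [hjk] using ha j (by omega)
    · have hjk : j ≠ k + 1 := by omega
      by_cases hj' : j = k
      · subst hj'; simpa using ⟨h₁, h₃⟩
      · simpa [hjk, hj'] using hd j (by omega)

theorem base_finite [Finite Pred] : P.base.Finite := by
  have h : ∀ p : Pred, {A : Atom Pred Const | A.pred = p ∧ A ∈ P.base}.Finite := fun p => by
    refine ((List.finite_length_eq P.herbrand (arity p)).image
      fun l => (⟨p, l.map Subtype.val⟩ : Atom Pred Const)).subset ?_
    rintro ⟨q, l⟩ ⟨rfl, hl, hmem⟩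
    exact ⟨l.attach.map fun c => ⟨c.1, hmem _ c.2⟩, by simpa using hl, by simp [Function.comp_def]⟩
  exact (Set.finite_iUnion h).subset fun A hA => Set.mem_iUnion.2 ⟨A.pred, rfl, hA⟩

/-- A later change would yield a chain with more entries than there are ground atoms, hence a
repetition, which positive correlation along the resulting cycle excludes. -/
theorem stage_card_base [Finite Pred] (hrec : ∀ p, P.Recursive p → P.disj p = .pc) :
    P.stage (P.base.ncard + 1) = P.stage P.base.ncard := by
  set N := P.base.ncard with hN
  funext A
  refine Conf.eq_of_coord fun π hπ => ?_
  by_contra hne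
  obtain ⟨a, -, ha, hd⟩ := P.exists_chain hπ N A hne
  have hlt : ∀ i j, i < j → j ≤ N → Relation.TransGen P.DependsOn (a j).1.pred (a i).1.pred := by
    intro i j hij
    induction hij with
    | refl => exact fun h => .single (hd i h).1
    | step _ ih => exact fun h => .head (hd _ h).1 (ih (Nat.le_of_succ_le h))
  have hinj : ∀ i j, i < j → j ≤ N → a i ≠ a j := by
    intro i j hij hj e
    -- Between two occurrences of the same atom the newly attained values cannot increase along the
    -- chain.
    have hle : ∀ l, i ≤ l → l ≤ j →
        π (P.stage (l + 1) (a l)) ≤ π (P.stage (i + 1) (a i)) := by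
      intro l hil
      induction hil with
      | refl => exact fun _ => le_rfl
      | @step l hil ih =>
        intro hlj
        have hil : i ≤ l := hil
        refine le_trans ((hd l (by omega)).2 (hrec _ ?_)) (ih (by omega))
        -- The predicate at l + 1 depends on that at i, which equals that at j, which in turn
        -- depends on the one at l + 1: the predicate is recursive.
        have h₁ := hlt i (l + 1) (by omega) (by omega)
        rcases Nat.lt_or_ge (l + 1) j with h | h
        · rw [e] at h₁
          exact h₁.trans (hlt _ _ h hj)
        · obtain rfl : l + 1 = j := by omega
          rwa [e] at h₁
    -- The value at stage j + 1 is at most that at stage i + 1, and i + 1 ≤ j; by monotonicity in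
    -- the stage nothing changes at j.
    have h₁ := hle j hij.le le_rfl
    have h₂ := hπ.mono (P.stage_mono (show i + 1 ≤ j by omega) (a j))
    have h₃ := hπ.mono (P.stage_mono (show j ≤ j + 1 by omega) (a j))
    rw [e] at h₁
    exact ha j hj (le_antisymm (h₁.trans h₂) h₃)
  have hinj' : Function.Injective fun i : Fin (N + 1) => a i := by
    intro i j e
    by_contra hij
    rcases lt_or_gt_of_ne hij with h | h
    · exact hinj i j h (by omega) e
    · exact hinj j i h (by omega) e.symm
  have := P.base_finite.to_subtype
  have hc := Nat.card_le_card_of_injective _ hinj'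
  rw [Nat.card_eq_fintype_card, Fintype.card_fin, Nat.card_coe_set_eq] at hc
  omega

end PProgram

/-! ### Values and costs of the list operations -/

namespace Timed

variable {α β : Type}

@[simp] theorem val_pure (a : α) : (pure a : Timed α).val = a := rfl
@[simp] theorem time_pure (a : α) : (pure a : Timed α).time = 0 := rfl
@[simp] theorem val_bind (x : Timed α) (f : α → Timed β) : (x >>= f).val = (f x.val).val := rfl
@[simp] theorem time_bind (x : Timed α) (f : α → Timed β) :
    (x >>= f).time = x.time + (f x.val).time := rfl
@[simp] theorem time_tick (n : ℕ) : (tick n).time = n := rfl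

end Timed

namespace Naive

variable {α β : Type}

/-! ### Lists -/

@[simp] theorem val_append (l k : List α) : (append l k).val = l ++ k := by
  induction l with
  | nil => simp [append]
  | cons a l ih => simp [append, ih]

@[simp] theorem time_append (l k : List α) : (append l k).time = l.length + 1 := by
  induction l with
  | nil => simp [append]
  | cons a l ih => simp [append, ih]; omega

@[simp] theorem val_map (f : α → Timed β) (l : List α) :
    (map f l).val = l.map fun a => (f a).val := by
  induction l with
  | nil => simp [map]
  | cons a l ih => simp [map, ih]

theorem time_map_le (f : α → Timed β) {l : List α} {n t : ℕ} (hn : l.length ≤ n)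
    (ht : ∀ a ∈ l, (f a).time ≤ t) : (map f l).time ≤ n * (t + 1) + 1 := by
  -- The bound `n` is first replaced by the actual length, which makes the claim inductive; the
  -- later cost bounds do the same.
  refine le_trans ?_ (Nat.add_le_add_right (Nat.mul_le_mul_right _ hn) _)
  induction l with
  | nil => simp [map]
  | cons a l ih =>
    have h₁ := ht a (by simp)
    have h₂ := ih ((Nat.le_succ _).trans hn) fun b hb => ht b (by simp [hb])
    simp only [map, Timed.time_bind, Timed.time_tick, Timed.time_pure, List.length_cons]
    linarith

@[simp] theorem val_flatMap (f : α → Timed (List β)) (l : List α) :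
    (flatMap f l).val = l.flatMap fun a => (f a).val := by
  induction l with
  | nil => simp [flatMap]
  | cons a l ih => simp [flatMap, ih]

theorem length_flatMap_le {l : List α} {f : α → List β} {n s : ℕ} (hn : l.length ≤ n)
    (hs : ∀ a ∈ l, (f a).length ≤ s) : (l.flatMap f).length ≤ n * s := by
  refine le_trans ?_ (Nat.mul_le_mul_right _ hn)
  induction l with
  | nil => simp
  | cons a l ih =>
    have h₁ := hs a (by simp)
    have h₂ := ih ((Nat.le_succ _).trans hn) fun b hb => hs b (by simp [hb])
    rw [List.flatMap_cons, List.length_append, List.length_cons]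
    linarith

theorem time_flatMap_le (f : α → Timed (List β)) {l : List α} {n t s : ℕ} (hn : l.length ≤ n)
    (ht : ∀ a ∈ l, (f a).time ≤ t) (hs : ∀ a ∈ l, (f a).val.length ≤ s) :
    (flatMap f l).time ≤ n * (t + s + 2) + 1 := by
  refine le_trans ?_ (Nat.add_le_add_right (Nat.mul_le_mul_right _ hn) _)
  induction l with
  | nil => simp [flatMap]
  | cons a l ih =>
    have h₁ := ht a (by simp)
    have h₂ := hs a (by simp)
    have h₃ := ih ((Nat.le_succ _).trans hn) (fun b hb => ht b (by simp [hb]))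
      fun b hb => hs b (by simp [hb])
    simp only [flatMap, Timed.time_bind, Timed.time_tick, time_append, List.length_cons]
    linarith

@[simp] theorem val_get (d : α) (l : List α) (i : ℕ) : (get d l i).val = l.getD i d := by
  induction l generalizing i with
  | nil => simp [get]
  | cons a l ih => cases i <;> simp [get, ih]

theorem time_get_le (d : α) (l : List α) (i : ℕ) : (get d l i).time ≤ l.length + 1 := by
  induction l generalizing i with
  | nil => simp [get]
  | cons a l ih =>
    cases i with
    | zero => simp [get]
    | succ i => have := ih i; simp [get]; omega

@[simp] theorem val_symEq [DecidableEq α] (a b : α) : (symEq a b).val = true ↔ a = b := by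
  simp [symEq]

@[simp] theorem time_symEq [DecidableEq α] (a b : α) : (symEq a b).time = 1 := rfl

@[simp] theorem val_confEq (c d : Conf) : (confEq c d).val = true ↔ c = d := by
  simp [confEq]

@[simp] theorem time_confEq (c d : Conf) : (confEq c d).time = 4 := rfl

@[simp] theorem val_modeEq (c d : Mode) : (modeEq c d).val = true ↔ c = d := by
  simp [modeEq]

@[simp] theorem time_modeEq (c d : Mode) : (modeEq c d).time = 1 := rfl

@[simp] theorem val_conj (μ : Mode) (c d : Conf) : (conj μ c d).val = Conf.conj μ c d := rfl

@[simp] theorem time_conj (μ : Mode) (c d : Conf) : (conj μ c d).time = 16 := rfl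

@[simp] theorem val_disj (μ : Mode) (c d : Conf) : (disj μ c d).val = Conf.disj μ c d := rfl

@[simp] theorem time_disj (μ : Mode) (c d : Conf) : (disj μ c d).time = 16 := rfl

/-- Stated for an arbitrary test because the iteration compares table entries by their confidence
only, which is not equality of entries. -/
theorem val_listEq (eq : α → α → Timed Bool) (l k : List α) :
    (listEq eq l k).val = true ↔ List.Forall₂ (fun a b => (eq a b).val = true) l k := by
  induction l generalizing k with
  | nil => cases k <;> simp [listEq]
  | cons a l ih =>
    cases k with
    | nil => simp [listEq]
    | cons b k =>
      by_cases h : (eq a b).val = true <;> simp [listEq, h, ih]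

theorem val_listEq_iff {eq : α → α → Timed Bool} (h : ∀ a b, (eq a b).val = true ↔ a = b)
    (l k : List α) : (listEq eq l k).val = true ↔ l = k := by
  simp only [val_listEq, h, List.forall₂_eq_eq_eq]

theorem time_listEq_le (eq : α → α → Timed Bool) {l k : List α} {n t : ℕ} (hn : l.length ≤ n)
    (ht : ∀ a ∈ l, ∀ b, (eq a b).time ≤ t) : (listEq eq l k).time ≤ n * (t + 1) + 1 := by
  refine le_trans ?_ (Nat.add_le_add_right (Nat.mul_le_mul_right _ hn) _)
  induction l generalizing k with
  | nil => cases k <;> simp [listEq]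
  | cons a l ih =>
    cases k with
    | nil => simp [listEq]
    | cons b k =>
      have h₁ := ht a (by simp) b
      have h₂ := ih (k := k) ((Nat.le_succ _).trans hn) fun b hb => ht b (by simp [hb])
      simp only [listEq, Timed.time_bind, Timed.time_tick, List.length_cons]
      split_ifs
      · linarith
      · simp only [Timed.time_pure]
        linarith

theorem val_mem {eq : α → α → Timed Bool} (h : ∀ a b, (eq a b).val = true ↔ a = b)
    (a : α) (l : List α) : (mem eq a l).val = true ↔ a ∈ l := by
  induction l with
  | nil => simp [mem]
  | cons b l ih =>
    by_cases hab : (eq a b).val = true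
    · obtain rfl := (h a b).1 hab
      simp [mem, hab]
    · simp [mem, hab, ih, mt (h a b).2 hab]

theorem time_mem_le (eq : α → α → Timed Bool) {a : α} {l : List α} {n t : ℕ} (hn : l.length ≤ n)
    (ht : ∀ b ∈ l, (eq a b).time ≤ t) : (mem eq a l).time ≤ n * (t + 1) + 1 := by
  refine le_trans ?_ (Nat.add_le_add_right (Nat.mul_le_mul_right _ hn) _)
  induction l with
  | nil => simp [mem]
  | cons b l ih =>
    have h₁ := ht b (by simp)
    have h₂ := ih ((Nat.le_succ _).trans hn) fun b hb => ht b (by simp [hb])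
    simp only [mem, Timed.time_bind, Timed.time_tick, List.length_cons]
    split_ifs
    · simp only [Timed.time_pure]
      linarith
    · linarith

theorem dedup_sublist (eq : α → α → Timed Bool) (l : List α) :
    List.Sublist (dedup eq l).val l := by
  induction l with
  | nil => simp [dedup]
  | cons a l ih =>
    simp only [dedup, Timed.val_bind]
    split_ifs
    · exact ih.cons a
    · exact ih.cons_cons a

theorem mem_dedup {eq : α → α → Timed Bool} (h : ∀ a b, (eq a b).val = true ↔ a = b)
    (l : List α) (a : α) : a ∈ (dedup eq l).val ↔ a ∈ l := by
  induction l with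
  | nil => simp [dedup]
  | cons b l ih =>
    simp only [dedup, Timed.val_bind, val_mem h]
    split_ifs with hb
    · rw [List.mem_cons, ← ih]
      exact ⟨Or.inr, fun h' => h'.elim (fun e => e ▸ (val_mem h _ _).1 hb) id⟩
    · rw [Timed.val_pure, List.mem_cons, List.mem_cons, ih]

theorem nodup_dedup {eq : α → α → Timed Bool} (h : ∀ a b, (eq a b).val = true ↔ a = b)
    (l : List α) : (dedup eq l).val.Nodup := by
  induction l with
  | nil => simp [dedup]
  | cons b l ih =>
    simp only [dedup, Timed.val_bind, val_mem h]
    split_ifs with hb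
    · exact ih
    · exact List.nodup_cons.2 ⟨mt (val_mem h _ _).2 hb, ih⟩

theorem time_dedup_le (eq : α → α → Timed Bool) {l : List α} {n t : ℕ} (hn : l.length ≤ n)
    (ht : ∀ a ∈ l, ∀ b, (eq a b).time ≤ t) :
    (dedup eq l).time ≤ n * (n * (t + 1) + 2) + 1 := by
  refine le_trans ?_ (Nat.add_le_add_right (Nat.mul_le_mul_right _ hn) _)
  induction l with
  | nil => simp [dedup]
  | cons a l ih =>
    have hn' : l.length ≤ n := (Nat.le_succ _).trans hn
    have h₁ := ih hn' fun b hb => ht b (by simp [hb])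
    have h₂ := time_mem_le eq (a := a) (((dedup_sublist eq l).length_le).trans hn')
      fun b _ => ht a (by simp) b
    simp only [dedup, Timed.time_bind, Timed.time_tick, List.length_cons]
    split_ifs <;> simp only [Timed.time_pure] <;> linarith

theorem val_tuples_succ (cs : List α) (k : ℕ) : (tuples cs (k + 1)).val =
    cs.flatMap fun c => (tuples cs k).val.map fun t => c :: t := by
  simp [tuples]

theorem mem_tuples (cs : List α) (k : ℕ) (t : List α) :
    t ∈ (tuples cs k).val ↔ t.length = k ∧ ∀ c ∈ t, c ∈ cs := by
  induction k generalizing t with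
  | zero =>
    simp only [tuples, Timed.val_bind, Timed.val_pure, List.mem_singleton, List.length_eq_zero_iff]
    exact ⟨fun h => ⟨h, by simp [h]⟩, And.left⟩
  | succ k ih =>
    rw [val_tuples_succ]
    simp only [List.mem_flatMap, List.mem_map, ih]
    constructor
    · rintro ⟨c, hc, t, ⟨rfl, ht⟩, rfl⟩
      exact ⟨rfl, by simpa using ⟨hc, ht⟩⟩
    · rintro ⟨hl, ht⟩
      cases t with
      | nil => simp at hl
      | cons c t => exact ⟨c, ht c (by simp), t, ⟨by simpa using hl, fun d hd => ht d (by simp [hd])⟩,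
          rfl⟩

theorem length_tuples (cs : List α) (k : ℕ) : (tuples cs k).val.length = cs.length ^ k := by
  induction k with
  | zero => simp [tuples]
  | succ k ih =>
    rw [val_tuples_succ, List.length_flatMap]
    simp [ih, pow_succ']

/-- The base u + 1 is positive even when u = 0, so the exponent may be enlarged to the uniform bound
w. -/
theorem length_tuples_le {cs : List α} {k u w : ℕ} (hu : cs.length ≤ u) (hk : k ≤ w) :
    (tuples cs k).val.length ≤ (u + 1) ^ w := by
  rw [length_tuples]
  exact (Nat.pow_le_pow_left (hu.trans (Nat.le_succ u)) k).trans
    (Nat.pow_le_pow_right (Nat.succ_pos u) hk)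

theorem time_tuples_le {cs : List α} {k u w : ℕ} (hu : cs.length ≤ u) (hk : k ≤ w) :
    (tuples cs k).time ≤ 8 * (w + 1) * (u + 1) ^ w := by
  -- The shorter tuples are computed once per level, so costs add up over levels. With P = (u +
  -- 1)^k, a new level costs at most 6uP + 2, which is below 8(u + 1)P.
  have key : (tuples cs k).time ≤ 8 * (k + 1) * (u + 1) ^ k := by
    clear hk
    induction k with
    | zero => simp [tuples]
    | succ k ih =>
      have hl : (tuples cs k).val.length ≤ (u + 1) ^ k := length_tuples_le hu le_rfl
      have h := time_flatMap_le
        (fun c => map (fun t => do Timed.tick 1; return c :: t) (tuples cs k).val) hu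
        (fun c _ => time_map_le (t := 1) _ hl (fun t _ => by simp))
        (s := (u + 1) ^ k) (fun c _ => by simpa using hl)
      simp only [tuples, Timed.time_bind, Timed.time_tick]
      have hp : 1 ≤ (u + 1) ^ k := Nat.one_le_pow _ _ (Nat.succ_pos u)
      have hk : k * (u + 1) ^ k ≥ 0 := Nat.zero_le _
      rw [pow_succ]
      nlinarith [Nat.zero_le (u * (u + 1) ^ k * k), Nat.mul_le_mul_left u hp]
  exact key.trans (Nat.mul_le_mul (by omega) (Nat.pow_le_pow_right (Nat.succ_pos u) hk))

end Naive

variable {Pred τ Const : Type}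

/-- The body and all the argument lists have length at most `w`. -/
structure PRule.SizeLE (w : ℕ) (r : PRule Pred τ) : Prop where
  body : r.body.length ≤ w
  args : ∀ A ∈ r.head :: r.body, A.args.length ≤ w

theorem PRule.SizeLE.subst {w : ℕ} {r : PRule Pred (Term Const)} (h : r.SizeLE w)
    (θ : ℕ → Const) : (r.subst θ).SizeLE w := by
  refine ⟨by rw [PProgram.body_subst, List.length_map]; exact h.body, fun A hA => ?_⟩
  rw [PProgram.body_subst, PProgram.head_subst, ← List.map_cons, List.mem_map] at hA
  obtain ⟨B, hB, rfl⟩ := hA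
  simpa [Atom.subst] using h.args B hB

theorem PRule.SizeLE.length_body {w : ℕ} {r : PRule Pred τ} (h : r.SizeLE w) :
    (r.head :: r.body).length ≤ w + 1 := Nat.succ_le_succ h.body

namespace Naive

section

variable [DecidableEq Pred] [DecidableEq Const]

@[simp] theorem val_atomEq (A B : Atom Pred Const) : (atomEq A B).val = true ↔ A = B := by
  by_cases h : (symEq A.pred B.pred).val = true
  · have h' := (val_symEq _ _).1 h
    simp [atomEq, h', val_listEq_iff val_symEq, Atom.ext_iff]
  · have h' := mt (val_symEq _ _).2 h
    simp [atomEq, h', Atom.ext_iff]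

theorem time_atomEq_le {A : Atom Pred Const} {w : ℕ} (hA : A.args.length ≤ w)
    (B : Atom Pred Const) : (atomEq A B).time ≤ 2 * w + 2 := by
  have := time_listEq_le (k := B.args) symEq hA (fun a _ b => (time_symEq a b).le)
  simp only [atomEq, Timed.time_bind, time_symEq]
  split_ifs
  · omega
  · simp

theorem val_ruleEq (g g' : PRule Pred Const) : (ruleEq g g').val = true ↔ g = g' := by
  cases g with
  | fact A c =>
    cases g' with
    | fact B d =>
      by_cases h : (atomEq A B).val = true
      · simp [ruleEq, (val_atomEq A B).1 h]
      · simp [ruleEq, h, mt (val_atomEq A B).2 h]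
    | rule B d ν bs => simp [ruleEq]
  | rule A c μ as =>
    cases g' with
    | fact B d => simp [ruleEq]
    | rule B d ν bs => simp [ruleEq, val_listEq_iff val_atomEq, and_assoc]

theorem time_ruleEq_le {g : PRule Pred Const} {w : ℕ} (hg : g.SizeLE w) (g' : PRule Pred Const) :
    (ruleEq g g').time ≤ w * (2 * w + 3) + 2 * w + 9 := by
  have h₀ : 0 ≤ w * (2 * w + 3) := Nat.zero_le _
  cases g with
  | fact A c =>
    cases g' with
    | fact B d =>
      have := time_atomEq_le (hg.args A (by simp [PRule.head])) B
      simp only [ruleEq, Timed.time_bind, Timed.time_tick]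
      split_ifs <;> simp <;> omega
    | rule B d ν bs => simp [ruleEq]
  | rule A c μ as =>
    cases g' with
    | fact B d => simp [ruleEq]
    | rule B d ν bs =>
      have h₁ := time_atomEq_le (hg.args A (by simp [PRule.head])) B
      have h₂ := time_listEq_le (k := bs) atomEq hg.body fun A' hA' B' =>
        time_atomEq_le (hg.args A' (List.mem_cons_of_mem _ hA')) B'
      simp only [PRule.body] at h₂
      simp only [ruleEq, Timed.time_bind, Timed.time_tick, time_confEq, time_modeEq,
        Timed.time_pure]
      linarith

end

/-! ### Grounding -/

@[simp] theorem val_atomConsts (A : Atom Pred (Term Const)) : (atomConsts A).val = A.consts := by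
  simp [atomConsts, Atom.consts]

@[simp] theorem val_ruleConsts (r : PRule Pred (Term Const)) : (ruleConsts r).val = r.consts := by
  simp [ruleConsts, PRule.consts]

theorem length_consts_le {r : PRule Pred (Term Const)} {w : ℕ} (hr : r.SizeLE w) :
    r.consts.length ≤ (w + 1) * w := by
  refine length_flatMap_le hr.length_body fun A hA => ?_
  refine (length_flatMap_le (hr.args A hA) (s := 1) fun t _ => ?_).trans (by omega)
  cases t <;> simp [Term.consts]

theorem time_ruleConsts_le {r : PRule Pred (Term Const)} {w : ℕ} (hr : r.SizeLE w) :
    (ruleConsts r).time ≤ (w + 1) * (w * 4 + 1 + w + 2) + 2 := by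
  have hc : ∀ A ∈ r.head :: r.body, (atomConsts A).time ≤ w * (1 + 1 + 2) + 1 := fun A hA =>
    time_flatMap_le _ (hr.args A hA) (fun t _ => by simp) fun t _ => by
      cases t <;> simp [Term.consts]
  have := time_flatMap_le atomConsts hr.length_body (s := w) hc fun A hA => by
    rw [val_atomConsts]
    refine (length_flatMap_le (hr.args A hA) (s := 1) fun t _ => ?_).trans (by omega)
    cases t <;> simp [Term.consts]
  simp only [ruleConsts, Timed.time_bind, Timed.time_tick]
  linarith

@[simp] theorem val_ruleVars (r : PRule Pred (Term Const)) :
    (ruleVars r).val = (r.head :: r.body).flatMap Atom.vars := by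
  simp only [ruleVars, termVars, Timed.val_bind, val_flatMap, Timed.val_pure]
  rfl

theorem length_vars_le {r : PRule Pred (Term Const)} {w : ℕ} (hr : r.SizeLE w) :
    ((r.head :: r.body).flatMap Atom.vars).length ≤ (w + 1) * w := by
  refine length_flatMap_le hr.length_body fun A hA => ?_
  refine (length_flatMap_le (hr.args A hA) (s := 1) fun t _ => ?_).trans (by omega)
  cases t <;> simp [Term.vars]

theorem time_ruleVars_le {r : PRule Pred (Term Const)} {w : ℕ} (hr : r.SizeLE w) :
    (ruleVars r).time ≤ (w + 1) * (w * 4 + 1 + w + 2) + 2 := by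
  have hc : ∀ A ∈ r.head :: r.body, (flatMap termVars A.args).time ≤ w * (1 + 1 + 2) + 1 :=
    fun A hA => time_flatMap_le _ (hr.args A hA) (fun t _ => by simp [termVars]) fun t _ => by
      cases t <;> simp [termVars, Term.vars]
  have := time_flatMap_le (fun A : Atom Pred (Term Const) => flatMap termVars A.args)
    hr.length_body (s := w) hc fun A hA => by
    rw [val_flatMap]
    refine (length_flatMap_le (hr.args A hA) (s := 1) fun t _ => ?_).trans (by omega)
    cases t <;> simp [termVars, Term.vars]
  simp only [ruleVars, Timed.time_bind, Timed.time_tick]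
  linarith

theorem lt_val_bound {l : List ℕ} {i : ℕ} (h : i ∈ l) : i < (bound l).val := by
  induction l with
  | nil => simp at h
  | cons j l ih =>
    simp only [bound, Timed.val_bind, Timed.val_pure]
    rcases List.mem_cons.1 h with rfl | h
    · exact (Nat.lt_succ_self _).trans_le (le_max_left _ _)
    · exact (ih h).trans_le (le_max_right _ _)

theorem val_bound_le {l : List ℕ} {w : ℕ} (h : ∀ i ∈ l, i < w) : (bound l).val ≤ w := by
  induction l with
  | nil => simp [bound]
  | cons j l ih =>
    simp only [bound, Timed.val_bind, Timed.val_pure]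
    exact max_le (h j (by simp)) (ih fun i hi => h i (by simp [hi]))

@[simp] theorem time_bound (l : List ℕ) : (bound l).time = l.length + 1 := by
  induction l with
  | nil => simp [bound]
  | cons j l ih => simp [bound, ih]; omega

section

variable [Inhabited Const]

theorem val_termSubst (θ : List Const) (t : Term Const) :
    (termSubst θ t).val = t.subst fun i => θ.getD i default := by
  cases t <;> simp [termSubst, Term.subst]

theorem time_termSubst_le {θ : List Const} {w : ℕ} (hθ : θ.length ≤ w) (t : Term Const) :
    (termSubst θ t).time ≤ w + 2 := by
  cases t with
  | var i =>
    have := time_get_le default θ i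
    simp [termSubst]; omega
  | const c => simp [termSubst]

theorem val_atomSubst (θ : List Const) (A : Atom Pred (Term Const)) :
    (atomSubst θ A).val = A.subst fun i => θ.getD i default := by
  simp [atomSubst, Atom.subst, val_termSubst]

theorem time_atomSubst_le {θ : List Const} {w : ℕ} (hθ : θ.length ≤ w)
    {A : Atom Pred (Term Const)} (hA : A.args.length ≤ w) :
    (atomSubst θ A).time ≤ w * (w + 3) + 2 := by
  have := time_map_le (termSubst θ) hA fun t _ => time_termSubst_le hθ t
  simp only [atomSubst, Timed.time_bind, Timed.time_tick, Timed.time_pure]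
  linarith

theorem val_ruleSubst (θ : List Const) (r : PRule Pred (Term Const)) :
    (ruleSubst θ r).val = r.subst fun i => θ.getD i default := by
  cases r <;> simp [ruleSubst, PRule.subst, val_atomSubst]

theorem time_ruleSubst_le {θ : List Const} {w : ℕ} (hθ : θ.length ≤ w)
    {r : PRule Pred (Term Const)} (hr : r.SizeLE w) :
    (ruleSubst θ r).time ≤ (w + 1) * (w * (w + 3) + 3) + 2 := by
  have h₁ := time_atomSubst_le hθ (hr.args r.head (by simp))
  have h₂ := time_map_le (atomSubst θ) hr.body fun A hA =>
    time_atomSubst_le hθ (hr.args A (List.mem_cons_of_mem _ hA))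
  cases r with
  | fact A c =>
    simp only [PRule.head] at h₁
    simp only [ruleSubst, Timed.time_bind, Timed.time_tick, Timed.time_pure]
    nlinarith
  | rule A c μ bs =>
    simp only [PRule.head, PRule.body] at h₁ h₂
    simp only [ruleSubst, Timed.time_bind, Timed.time_tick, Timed.time_pure]
    linarith

/-- Only the variables of the rule matter, and their indices are below the tuple length; hence
finite tuples give the same instances as total substitutions. -/
theorem mem_instances {cs : List Const} (hcs : cs ≠ []) (r : PRule Pred (Term Const))
    (g : PRule Pred Const) :
    g ∈ (instances cs r).val ↔ ∃ θ : ℕ → Const, (∀ i, θ i ∈ cs) ∧ g = r.subst θ := by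
  simp only [instances, Timed.val_bind, val_map, val_ruleVars, List.mem_map, mem_tuples,
    val_ruleSubst]
  set k := (bound ((r.head :: r.body).flatMap Atom.vars)).val with hk
  have hlt : ∀ A ∈ r.head :: r.body, ∀ i ∈ A.vars, i < k := fun A hA i hi =>
    lt_val_bound (List.mem_flatMap.2 ⟨A, hA, hi⟩)
  constructor
  · rintro ⟨t, ⟨ht, hmem⟩, rfl⟩
    -- The algorithm pads with `default`, which need not belong to `cs`; padding with a member of
    -- `cs` instead agrees on all variables of the rule.
    obtain ⟨c, hc⟩ := List.exists_mem_of_ne_nil cs hcs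
    refine ⟨fun i => t.getD i c, fun i => ?_, r.subst_congr fun A hA i hi => ?_⟩
    · by_cases hi : i < t.length
      · dsimp only
        rw [List.getD_eq_getElem _ _ hi]
        exact hmem _ (List.getElem_mem hi)
      · dsimp only
        rw [List.getD_eq_default _ _ (not_lt.1 hi)]
        exact hc
    · have hi' : i < t.length := ht ▸ hlt A hA i hi
      simp only [List.getD_eq_getElem _ _ hi']
  · rintro ⟨θ, hθ, rfl⟩
    refine ⟨(List.range k).map θ, ⟨by simp, fun c hc => ?_⟩, r.subst_congr fun A hA i hi => ?_⟩
    · obtain ⟨i, -, rfl⟩ := List.mem_map.1 hc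
      exact hθ i
    · have := hlt A hA i hi
      rw [List.getD_eq_getElem _ _ (by simpa using this)]
      simp

theorem length_instances_le {cs : List Const} {r : PRule Pred (Term Const)} {u w : ℕ}
    (hu : cs.length ≤ u) (hv : ∀ A ∈ r.head :: r.body, ∀ i ∈ A.vars, i < w) :
    (instances cs r).val.length ≤ (u + 1) ^ w := by
  simp only [instances, Timed.val_bind, val_map, val_ruleVars, List.length_map]
  exact length_tuples_le hu (val_bound_le fun i hi => by
    obtain ⟨A, hA, hi⟩ := List.mem_flatMap.1 hi
    exact hv A hA i hi)

/-- A bound of the cost of instantiating a rule of size `w` over `u` constants. -/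
def instancesCost (w u : ℕ) : ℕ :=
  ((w + 1) * (w * 4 + 1 + w + 2) + 2) + ((w + 1) * w + 1) + 8 * (w + 1) * (u + 1) ^ w +
    ((u + 1) ^ w * ((w + 1) * (w * (w + 3) + 3) + 2 + 1) + 1)

theorem time_instances_le {cs : List Const} {r : PRule Pred (Term Const)} {u w : ℕ}
    (hu : cs.length ≤ u) (hr : r.SizeLE w)
    (hv : ∀ A ∈ r.head :: r.body, ∀ i ∈ A.vars, i < w) :
    (instances cs r).time ≤ instancesCost w u := by
  have hk : (bound ((r.head :: r.body).flatMap Atom.vars)).val ≤ w := val_bound_le fun i hi => by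
    obtain ⟨A, hA, hi⟩ := List.mem_flatMap.1 hi
    exact hv A hA i hi
  have h₁ := time_ruleVars_le hr
  have h₂ := length_vars_le hr
  have h₃ := time_tuples_le hu hk
  have h₄ := time_map_le (fun θ => ruleSubst θ r) (length_tuples_le hu hk) fun θ hθ =>
    time_ruleSubst_le (((mem_tuples _ _ _).1 hθ).1.le.trans hk) hr
  simp only [instances, Timed.time_bind, val_ruleVars, time_bound, instancesCost]
  linarith

end

/-! ### Set-up -/

section

variable [DecidableEq Pred] [DecidableEq Const] [Inhabited Const]

/-- The constants of a list of p-rules, or one arbitrary constant if there are none. -/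
def herbrandList (rules : List (PRule Pred (Term Const))) : List Const :=
  match (dedup symEq (flatMap ruleConsts rules).val).val with
  | [] => [default]
  | c :: l => c :: l

omit [DecidableEq Pred] in
theorem herbrandList_ne_nil (rules : List (PRule Pred (Term Const))) : herbrandList rules ≠ [] := by
  unfold herbrandList
  split <;> simp

variable {arity : Pred → ℕ} (P : PProgram Pred Const arity) {rules : List (PRule Pred (Term Const))}

omit [DecidableEq Pred] [Inhabited Const] in
theorem toFinset_dedup_consts (hrules : ∀ r, r ∈ rules ↔ r ∈ P.rules) :
    (dedup symEq (flatMap ruleConsts rules).val).val.toFinset = P.consts := by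
  ext c
  simp [mem_dedup val_symEq, PProgram.consts, hrules]

omit [DecidableEq Pred] in
theorem mem_herbrandList (hrules : ∀ r, r ∈ rules ↔ r ∈ P.rules) (c : Const) :
    c ∈ herbrandList rules ↔ c ∈ P.herbrand := by
  unfold herbrandList PProgram.herbrand
  rw [← toFinset_dedup_consts P hrules]
  split <;> rename_i h <;> rw [h] <;> simp

omit [DecidableEq Pred] in
-- The extra 1 pays for the arbitrary constant of a program without constants.
theorem length_herbrandList_le (hrules : ∀ r, r ∈ rules ↔ r ∈ P.rules) :
    (herbrandList rules).length ≤ P.dbSize + 1 := by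
  have h := List.toFinset_card_of_nodup
    (nodup_dedup val_symEq (flatMap (ruleConsts (Pred := Pred) (Const := Const)) rules).val)
  rw [toFinset_dedup_consts P hrules] at h
  unfold herbrandList PProgram.dbSize
  rw [h]
  split <;> rename_i h' <;> rw [h'] <;> simp

/-- The ground p-rules computed by the set-up. -/
noncomputable def groundRules (rules : List (PRule Pred (Term Const))) : List (PRule Pred Const) :=
  (dedup ruleEq (rules.flatMap fun r => (instances (herbrandList rules) r).val)).val

/-- The ground atoms over a list of constants. -/
def groundAtoms (arity : Pred → ℕ) (preds : List Pred) (cs : List Const) :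
    List (Atom Pred Const) :=
  preds.flatMap fun p => (tuples cs (arity p)).val.map (Atom.mk p)

theorem val_setup (arity : Pred → ℕ) (preds : List Pred) (rules : List (PRule Pred (Term Const))) :
    (setup arity preds rules).val = (groundRules rules,
      (groundAtoms arity preds (herbrandList rules)).map fun A => (A, Conf.falsum)) := by
  -- Definitional unfolding, with the match on the list of constants folded into `herbrandList`.
  have e : (setup arity preds rules).val =
      ((dedup ruleEq (flatMap (instances (herbrandList rules)) rules).val).val,
        (flatMap (fun p => do
          Timed.tick 1
          let ts ← tuples (herbrandList rules) (arity p)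
          map (fun t => do Timed.tick 1; return ((⟨p, t⟩ : Atom Pred Const), Conf.falsum)) ts)
          preds).val) := rfl
  rw [e]
  simp only [Timed.val_bind, val_flatMap, val_map, Timed.val_pure, groundRules, groundAtoms,
    List.map_flatMap, List.map_map]
  rfl

theorem nodup_groundRules (rules : List (PRule Pred (Term Const))) : (groundRules rules).Nodup :=
  nodup_dedup val_ruleEq _

theorem mem_groundRules (hrules : ∀ r, r ∈ rules ↔ r ∈ P.rules) (g : PRule Pred Const) :
    g ∈ groundRules rules ↔ g ∈ P.ground := by
  simp only [groundRules, mem_dedup val_ruleEq, List.mem_flatMap,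
    mem_instances (herbrandList_ne_nil rules), hrules, mem_herbrandList P hrules, PProgram.ground,
    Set.mem_ofPred_eq]

omit [DecidableEq Pred] in
theorem mem_groundAtoms {preds : List Pred} (hpreds : ∀ p, p ∈ preds) {cs : List Const}
    (hcs : ∀ c, c ∈ cs ↔ c ∈ P.herbrand) (A : Atom Pred Const) :
    A ∈ groundAtoms arity preds cs ↔ A ∈ P.base := by
  simp only [groundAtoms, List.mem_flatMap, List.mem_map, mem_tuples, hcs, PProgram.base,
    Set.mem_ofPred_eq]
  constructor
  · rintro ⟨p, -, t, ht, rfl⟩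
    exact ht
  · exact fun h => ⟨A.pred, hpreds _, A.args, h, rfl⟩

omit [DecidableEq Pred] [DecidableEq Const] [Inhabited Const] in
theorem length_groundAtoms_le (preds : List Pred) {cs : List Const} {u w : ℕ}
    (hu : cs.length ≤ u) (hw : ∀ p, arity p ≤ w) :
    (groundAtoms arity preds cs).length ≤ preds.length * (u + 1) ^ w :=
  length_flatMap_le le_rfl fun p _ => by
    rw [List.length_map]; exact length_tuples_le hu (hw p)

theorem length_groundRules_le {u w L : ℕ} (hL : rules.length ≤ L)
    (hu : (herbrandList rules).length ≤ u)
    (hv : ∀ r ∈ rules, ∀ A ∈ r.head :: r.body, ∀ i ∈ A.vars, i < w) :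
    (groundRules rules).length ≤ L * (u + 1) ^ w :=
  (dedup_sublist _ _).length_le.trans <|
    length_flatMap_le hL fun r hr => length_instances_le hu (hv r hr)

theorem sizeLE_of_mem_groundRules {w : ℕ} (hs : ∀ r ∈ rules, r.SizeLE w) {g : PRule Pred Const}
    (hg : g ∈ groundRules rules) : g.SizeLE w := by
  simp only [groundRules, mem_dedup val_ruleEq, List.mem_flatMap,
    mem_instances (herbrandList_ne_nil rules)] at hg
  obtain ⟨r, hr, θ, -, rfl⟩ := hg
  exact (hs r hr).subst θ

/-- A bound of the cost of the set-up for `p` predicates and `L` rules of size `w` with `u`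
constants. -/
def setupCost (w p L u : ℕ) : ℕ :=
  (L * ((w + 1) * (w * 4 + 1 + w + 2) + 2 + (w + 1) * w + 2) + 1) +
  (L * ((w + 1) * w) * (L * ((w + 1) * w) * (1 + 1) + 2) + 1) + 1 +
  (L * (instancesCost w u + (u + 1) ^ w + 2) + 1) +
  (L * (u + 1) ^ w * (L * (u + 1) ^ w * (w * (2 * w + 3) + 2 * w + 9 + 1) + 2) + 1) +
  (p * (1 + 8 * (w + 1) * (u + 1) ^ w + ((u + 1) ^ w * (1 + 1) + 1) + (u + 1) ^ w + 2) + 1)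

theorem time_setup_le (preds : List Pred) {u w L : ℕ} (hL : rules.length ≤ L)
    (hu : (herbrandList rules).length ≤ u) (hs : ∀ r ∈ rules, r.SizeLE w)
    (hv : ∀ r ∈ rules, ∀ A ∈ r.head :: r.body, ∀ i ∈ A.vars, i < w)
    (hw : ∀ p, arity p ≤ w) :
    (setup arity preds rules).time ≤ setupCost w preds.length L u := by
  have h₁ := time_flatMap_le ruleConsts hL (fun r hr => time_ruleConsts_le (hs r hr))
    (fun r hr => by rw [val_ruleConsts]; exact length_consts_le (hs r hr))
  have h₂ : (dedup symEq (flatMap ruleConsts rules).val).time ≤ _ :=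
    time_dedup_le symEq (n := L * ((w + 1) * w))
    (by rw [val_flatMap]
        exact length_flatMap_le hL fun r hr => by
          rw [val_ruleConsts]; exact length_consts_le (hs r hr))
    fun a _ b => (time_symEq a b).le
  have h₃ := time_flatMap_le (instances (herbrandList rules)) hL
    (fun r hr => time_instances_le hu (hs r hr) (hv r hr))
    (fun r hr => length_instances_le hu (hv r hr))
  have h₄ : (dedup ruleEq (flatMap (instances (herbrandList rules)) rules).val).time ≤ _ :=
    time_dedup_le ruleEq (n := L * (u + 1) ^ w)
    (by rw [val_flatMap]
        exact length_flatMap_le hL fun r hr => length_instances_le hu (hv r hr))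
    (fun g hg g' => by
      simp only [val_flatMap, List.mem_flatMap, mem_instances (herbrandList_ne_nil rules)] at hg
      obtain ⟨r, hr, θ, -, rfl⟩ := hg
      exact time_ruleEq_le ((hs r hr).subst θ) g')
  have h₅ := time_flatMap_le (fun p => do
    Timed.tick 1
    let ts ← tuples (herbrandList rules) (arity p)
    map (fun t => do Timed.tick 1; return ((⟨p, t⟩ : Atom Pred Const), Conf.falsum)) ts)
    (le_refl preds.length)
    (t := 1 + 8 * (w + 1) * (u + 1) ^ w + ((u + 1) ^ w * (1 + 1) + 1)) (s := (u + 1) ^ w)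
    (fun p _ => by
      have h₁ := time_tuples_le hu (hw p)
      have h₂ := time_map_le (t := 1)
        (fun t => do Timed.tick 1; return ((⟨p, t⟩ : Atom Pred Const), Conf.falsum))
        (length_tuples_le hu (hw p)) (fun t _ => by simp)
      simp only [Timed.time_bind, Timed.time_tick] at h₂ ⊢
      linarith)
    (fun p _ => by simpa using length_tuples_le hu (hw p))
  have e : (setup arity preds rules).time = (flatMap ruleConsts rules).time +
      ((dedup symEq (flatMap ruleConsts rules).val).time + (1 +
      ((flatMap (instances (herbrandList rules)) rules).time +
      ((dedup ruleEq (flatMap (instances (herbrandList rules)) rules).val).time +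
      ((flatMap (fun p => do
        Timed.tick 1
        let ts ← tuples (herbrandList rules) (arity p)
        map (fun t => do Timed.tick 1; return ((⟨p, t⟩ : Atom Pred Const), Conf.falsum)) ts)
        preds).time + 0))))) := rfl
  rw [e]
  unfold setupCost
  linarith

end

end Naive

namespace Naive

variable {Pred Const : Type} [DecidableEq Pred] [DecidableEq Const]

/-! ### Iteration -/

/-- The default of `lookup` is also the value of a valuation outside the base. Repeated atoms would
be harmless, as their entries agree. -/
theorem val_lookup (f : Atom Pred Const → Conf) (as : List (Atom Pred Const))
    (A : Atom Pred Const) (h : A ∉ as → f A = Conf.falsum) :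
    (lookup A (as.map fun B => (B, f B))).val = f A := by
  induction as with
  | nil => simp [lookup, h]
  | cons B as ih =>
    by_cases hAB : (atomEq A B).val = true
    · simp [lookup, (val_atomEq A B).1 hAB]
    · have hne := mt (val_atomEq A B).2 hAB
      simp [lookup, hAB, ih fun hn => h (by simp [hn, hne])]

theorem time_lookup_le {A : Atom Pred Const} {w n : ℕ} (hA : A.args.length ≤ w)
    {tab : Table Pred Const} (hn : tab.length ≤ n) :
    (lookup A tab).time ≤ n * (2 * w + 3) + 1 := by
  refine le_trans ?_ (Nat.add_le_add_right (Nat.mul_le_mul_right _ hn) _)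
  induction tab with
  | nil => simp [lookup]
  | cons e tab ih =>
    have h₁ := time_atomEq_le hA e.1
    have h₂ := ih ((Nat.le_succ _).trans hn)
    simp only [lookup, Timed.time_bind, Timed.time_tick, List.length_cons]
    split_ifs
    · simp only [Timed.time_pure]
      linarith
    · linarith

theorem val_bodyConf {f : Atom Pred Const → Conf} {tab : Table Pred Const}
    (h : ∀ A, (lookup A tab).val = f A) (μ : Mode) (c : Conf) (bs : List (Atom Pred Const)) :
    (bodyConf tab μ c bs).val = bs.foldl (fun x B => Conf.conj μ x (f B)) c := by
  induction bs generalizing c with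
  | nil => simp [bodyConf]
  | cons B bs ih => simp [bodyConf, h, ih]

theorem time_bodyConf_le {tab : Table Pred Const} {w n : ℕ} (hn : tab.length ≤ n) (μ : Mode)
    (c : Conf) {bs : List (Atom Pred Const)} (hw : bs.length ≤ w)
    (ha : ∀ A ∈ bs, A.args.length ≤ w) :
    (bodyConf tab μ c bs).time ≤ w * (n * (2 * w + 3) + 18) + 1 := by
  refine le_trans ?_ (Nat.add_le_add_right (Nat.mul_le_mul_right _ hw) _)
  induction bs generalizing c with
  | nil => simp [bodyConf]
  | cons B bs ih =>
    have h₁ := time_lookup_le (ha B (by simp)) hn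
    have h₂ := ih (Conf.conj μ c (lookup B tab).val) ((Nat.le_succ _).trans hw)
      fun A hA => ha A (by simp [hA])
    simp only [bodyConf, Timed.time_bind, Timed.time_tick, time_conj, val_conj, List.length_cons]
    linarith

theorem val_ruleConf {f : Atom Pred Const → Conf} {tab : Table Pred Const}
    (h : ∀ A, (lookup A tab).val = f A) (g : PRule Pred Const) :
    (ruleConf tab g).val = g.ruleConf f := by
  cases g with
  | fact A c => simp [ruleConf, PRule.ruleConf]
  | rule A c μ bs => simp [ruleConf, PRule.ruleConf, val_bodyConf h]

theorem time_ruleConf_le {tab : Table Pred Const} {w n : ℕ} (hn : tab.length ≤ n)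
    {g : PRule Pred Const} (hg : g.SizeLE w) :
    (ruleConf tab g).time ≤ w * (n * (2 * w + 3) + 18) + 2 := by
  cases g with
  | fact A c => simp [ruleConf]
  | rule A c μ bs =>
    have := time_bodyConf_le hn μ c hg.body fun A hA => hg.args A (List.mem_cons_of_mem _ hA)
    simp only [PRule.body] at this
    simp only [ruleConf, Timed.time_bind, Timed.time_tick]
    linarith

/-- Disjunction is commutative and associative but not idempotent in general, so the list must be
free of repetitions. The set `s` is given by its members only, so that the induction may erase the
head of the list. -/
theorem val_atomConf {f : Atom Pred Const → Conf} {tab : Table Pred Const}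
    (h : ∀ A, (lookup A tab).val = f A) (μ : Mode) (A : Atom Pred Const)
    {gs : List (PRule Pred Const)} (hgs : gs.Nodup) {s : Finset (PRule Pred Const)}
    (hs : ∀ g, g ∈ s ↔ g ∈ gs ∧ g.head = A) :
    (atomConf μ tab A gs).val = s.fold (Conf.disj μ) Conf.falsum (PRule.ruleConf f) := by
  classical
  induction gs generalizing s with
  | nil =>
    obtain rfl : s = ∅ := Finset.eq_empty_of_forall_notMem fun g hg => by simpa using (hs g).1 hg
    simp [atomConf]
  | cons g gs ih =>
    obtain ⟨hg, hgs⟩ := List.nodup_cons.1 hgs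
    by_cases hA : (atomEq g.head A).val = true
    · have hA' := (val_atomEq _ _).1 hA
      have e : s = insert g (s.erase g) := by
        rw [Finset.insert_erase]; exact (hs g).2 ⟨by simp, hA'⟩
      rw [e, Finset.fold_insert (by simp)]
      simp only [atomConf, Timed.val_bind, hA, if_true, val_disj, val_ruleConf h]
      rw [ih hgs (s := s.erase g)]
      intro g'
      rw [Finset.mem_erase, hs, List.mem_cons]
      constructor
      · rintro ⟨h₁, h₂, h₃⟩
        exact ⟨h₂.resolve_left h₁, h₃⟩
      · rintro ⟨h₁, h₂⟩
        exact ⟨fun e => hg (e ▸ h₁), Or.inr h₁, h₂⟩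
    · have hA' := mt (val_atomEq _ _).2 hA
      simp only [atomConf, Timed.val_bind, hA]
      refine ih hgs fun g' => ?_
      rw [hs, List.mem_cons]
      constructor
      · rintro ⟨rfl | h₂, h₃⟩
        · exact absurd h₃ hA'
        · exact ⟨h₂, h₃⟩
      · exact fun ⟨h₁, h₂⟩ => ⟨Or.inr h₁, h₂⟩

theorem time_atomConf_le {tab : Table Pred Const} {w n G : ℕ} (hn : tab.length ≤ n) (μ : Mode)
    (A : Atom Pred Const) {gs : List (PRule Pred Const)} (hG : gs.length ≤ G)
    (hs : ∀ g ∈ gs, g.SizeLE w) :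
    (atomConf μ tab A gs).time ≤ G * (w * (n * (2 * w + 3) + 18) + 2 * w + 21) + 1 := by
  refine le_trans ?_ (Nat.add_le_add_right (Nat.mul_le_mul_right _ hG) _)
  induction gs with
  | nil => simp [atomConf]
  | cons g gs ih =>
    have h₁ := time_atomEq_le ((hs g (by simp)).args g.head (by simp)) A
    have h₂ := time_ruleConf_le hn (hs g (by simp))
    have h₃ := ih ((Nat.le_succ _).trans hG) fun g' hg' => hs g' (by simp [hg'])
    simp only [atomConf, Timed.time_bind, Timed.time_tick, List.length_cons]
    split_ifs <;> simp only [Timed.time_bind, Timed.time_pure, time_disj] <;> linarith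

/-- A bound of the cost of an iteration, for `n` ground atoms and `G` ground p-rules of
size `w`. -/
def iterationCost (w n G : ℕ) : ℕ :=
  n * (G * (w * (n * (2 * w + 3) + 18) + 2 * w + 21) + 3) + 1 + (n * 5 + 1)

theorem time_iteration_le (modes : Pred → Mode) {tab : Table Pred Const} {w n G : ℕ}
    (hn : tab.length ≤ n) {gs : List (PRule Pred Const)} (hG : gs.length ≤ G)
    (hs : ∀ g ∈ gs, g.SizeLE w) :
    (iteration modes gs tab).time ≤ iterationCost w n G := by
  have h₁ := time_map_le (fun e : Atom Pred Const × Conf => do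
    Timed.tick 1
    let c ← atomConf (modes e.1.pred) tab e.1 gs
    return (e.1, c)) hn (t := G * (w * (n * (2 * w + 3) + 18) + 2 * w + 21) + 2) fun e _ => by
      have := time_atomConf_le hn (modes e.1.pred) e.1 hG hs
      simp only [Timed.time_bind, Timed.time_tick, Timed.time_pure]
      linarith
  have h₂ := time_listEq_le (k := (map (fun e : Atom Pred Const × Conf => do
    Timed.tick 1
    let c ← atomConf (modes e.1.pred) tab e.1 gs
    return (e.1, c)) tab).val) (fun e e' => confEq e.2 e'.2) hn fun a _ b => (time_confEq a.2 b.2).le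
  simp only [iteration, Timed.time_bind, Timed.time_pure, iterationCost]
  linarith

section

variable [Inhabited Const] {arity : Pred → ℕ} (P : PProgram Pred Const arity)

/-- The table of a valuation. -/
noncomputable def tableOf (as : List (Atom Pred Const)) (v : P.Valuation) : Table Pred Const :=
  as.map fun A => (A, P.value v A)

variable {as : List (Atom Pred Const)} (has : ∀ A, A ∈ as ↔ A ∈ P.base)
include has

theorem val_lookup_tableOf (v : P.Valuation) (A : Atom Pred Const) :
    (lookup A (tableOf P as v)).val = P.value v A :=
  val_lookup _ _ _ fun h => P.value_of_notMem (mt (has A).2 h)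

/-- The link between algorithm and semantics: on tables of valuations, one iteration is one
application of the operator. -/
theorem val_iteration {gs : List (PRule Pred Const)} (hnd : gs.Nodup)
    (hgs : ∀ g, g ∈ gs ↔ g ∈ P.ground) (v : P.Valuation) :
    (iteration P.disj gs (tableOf P as v)).val.1 = tableOf P as (P.immCons v) := by
  simp only [iteration, Timed.val_bind, Timed.val_pure, val_map, tableOf, List.map_map]
  refine List.map_congr_left fun A hA => ?_
  have hA' := (has A).1 hA
  simp only [Function.comp, Prod.mk.injEq, true_and]
  rw [P.value_of_mem hA']
  exact val_atomConf (val_lookup_tableOf P has v) _ A hnd (by simp [hgs])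

theorem iteration_eq_true_iff {gs : List (PRule Pred Const)} (hnd : gs.Nodup)
    (hgs : ∀ g, g ∈ gs ↔ g ∈ P.ground) (v : P.Valuation) :
    (iteration P.disj gs (tableOf P as v)).val.2 = true ↔ P.immCons v = v := by
  have e : (iteration P.disj gs (tableOf P as v)).val.2 =
      (listEq (fun e e' => confEq e.2 e'.2) (tableOf P as v)
        (iteration P.disj gs (tableOf P as v)).val.1).val := rfl
  rw [e, val_iteration P has hnd hgs, val_listEq]
  simp only [tableOf, List.forall₂_map_left_iff, List.forall₂_map_right_iff, val_confEq,
    List.forall₂_same]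
  constructor
  · intro h
    funext A
    have := h A.1 ((has _).2 A.2)
    rw [P.value_of_mem A.2, P.value_of_mem A.2] at this
    exact this.symm
  · intro h A _
    rw [h]

omit [DecidableEq Pred] in
theorem mem_tableOf (v : P.Valuation) (A : Atom Pred Const) (c : Conf) :
    (A, c) ∈ tableOf P as v ↔ ∃ h : A ∈ P.base, v ⟨A, h⟩ = c := by
  simp only [tableOf, List.mem_map, Prod.mk.injEq]
  constructor
  · rintro ⟨B, hB, rfl, rfl⟩
    exact ⟨(has B).1 hB, (P.value_of_mem _).symm⟩
  · rintro ⟨h, rfl⟩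
    exact ⟨A, (has A).2 h, rfl, P.value_of_mem h⟩

/-- If stage `k + N` is a fixpoint, then iterating from stage `k` halts within `N + 1`
iterations. -/
theorem exists_loop {gs : List (PRule Pred Const)} (hnd : gs.Nodup)
    (hgs : ∀ g, g ∈ gs ↔ g ∈ P.ground) {t : ℕ}
    (ht : ∀ v, (iteration P.disj gs (tableOf P as v)).time ≤ t) (N : ℕ) :
    ∀ k, P.stage (k + N + 1) = P.stage (k + N) →
      ∃ costs : List ℕ,
        Loop P.disj gs (tableOf P as (P.stage k)) costs
          (tableOf P as (P.stage (k + costs.length))) ∧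
        P.immCons (P.stage (k + costs.length)) = P.stage (k + costs.length) ∧
        costs.length ≤ N + 1 ∧ ∀ c ∈ costs, c ≤ t := by
  induction N with
  | zero =>
    intro k hk
    have h := (iteration_eq_true_iff P has hnd hgs (P.stage k)).2 (by rw [← P.stage_succ]; exact hk)
    have hl := Loop.halt _ h
    rw [val_iteration P has hnd hgs, ← P.stage_succ] at hl
    refine ⟨_, hl, ?_, le_rfl, by simpa using ht _⟩
    simp only [List.length_singleton, P.stage_succ, (iteration_eq_true_iff P has hnd hgs _).1 h]
  | succ N ih =>
    intro k hk
    by_cases h : (iteration P.disj gs (tableOf P as (P.stage k))).val.2 = true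
    -- The verifying iteration also applies the operator, so its output is the table of stage k + 1,
    -- which equals stage k.
    · have hl := Loop.halt _ h
      rw [val_iteration P has hnd hgs, ← P.stage_succ] at hl
      refine ⟨_, hl, ?_, by simp, by simpa using ht _⟩
      simp only [List.length_singleton, P.stage_succ, (iteration_eq_true_iff P has hnd hgs _).1 h]
    · obtain ⟨costs, hl, hfix, hlen, hc⟩ := ih (k + 1)
        (by rw [show k + 1 + N = k + (N + 1) by omega]; exact hk)
      have hl' := Loop.next (tableOf P as (P.stage k)) costs
        (tableOf P as (P.stage (k + 1 + costs.length))) (Bool.eq_false_iff.2 h)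
        (by rw [val_iteration P has hnd hgs, ← P.stage_succ]; exact hl)
      have e : k + 1 + costs.length = k + (costs.length + 1) := by omega
      rw [e] at hl' hfix
      exact ⟨_, hl', hfix, by simpa using hlen, by simpa using ⟨ht _, hc⟩⟩

end

end Naive

/-! ### Size of the program in terms of the number of constants -/

namespace PProgram

variable {Pred Const : Type} {arity : Pred → ℕ} (P : PProgram Pred Const arity)

/-- Range restriction with an empty body leaves no room for a variable. -/
theorem vars_eq_nil_of_isFact {r : PRule Pred (Term Const)} (hr : r ∈ P.rules) (hf : r.IsFact) :
    r.head.vars = [] := by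
  refine List.eq_nil_iff_forall_not_mem.2 fun x hx => ?_
  obtain ⟨B, hB, -⟩ := P.range_restricted r hr x hx
  cases r with
  | fact A c => simp [PRule.body] at hB
  | rule => exact hf

theorem isFact_or_mem_properRules {r : PRule Pred (Term Const)} (hr : r ∈ P.rules) :
    r.IsFact ∨ r ∈ P.properRules := by
  by_cases h : r.IsFact
  · exact Or.inl h
  · exact Or.inr (by simp [properRules, hr, h])

theorem body_eq_nil_of_isFact {r : PRule Pred (Term Const)} (hf : r.IsFact) : r.body = [] := by
  cases r with
  | fact => rfl
  | rule => exact hf.elim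

/-- A size bound for the p-rules of a program with proper rules `R`. -/
def sizeBound [Fintype Pred] (arity : Pred → ℕ) (R : Finset (PRule Pred (Term Const))) : ℕ :=
  ∑ p, arity p + ∑ r ∈ R, (r.body.length + (((r.head :: r.body).flatMap Atom.vars).sum + 1))

section

variable [Fintype Pred]

theorem arity_le_sizeBound (R : Finset (PRule Pred (Term Const))) (p : Pred) :
    arity p ≤ sizeBound arity R :=
  (Finset.single_le_sum (fun _ _ => Nat.zero_le _) (Finset.mem_univ p)).trans (Nat.le_add_right _ _)

theorem sizeLE_sizeBound {r : PRule Pred (Term Const)} (hr : r ∈ P.rules) :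
    r.SizeLE (sizeBound arity P.properRules) := by
  refine ⟨?_, fun A hA => (P.arity_eq r hr A hA).le.trans (arity_le_sizeBound _ _)⟩
  rcases P.isFact_or_mem_properRules hr with h | h
  · simp [body_eq_nil_of_isFact h]
  · have := Finset.single_le_sum (f := fun r : PRule Pred (Term Const) =>
      r.body.length + (((r.head :: r.body).flatMap Atom.vars).sum + 1))
      (fun _ _ => Nat.zero_le _) h
    simp only [sizeBound]
    omega

/-- Facts have no variables, so a bound computed from the fixed proper rules serves for all data; an
index is at most the sum of all indices of its rule. -/
theorem vars_lt_sizeBound {r : PRule Pred (Term Const)} (hr : r ∈ P.rules)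
    {A : Atom Pred (Term Const)} (hA : A ∈ r.head :: r.body) {i : ℕ} (hi : i ∈ A.vars) :
    i < sizeBound arity P.properRules := by
  rcases P.isFact_or_mem_properRules hr with h | h
  · rw [body_eq_nil_of_isFact h, List.mem_singleton] at hA
    rw [hA, P.vars_eq_nil_of_isFact hr h] at hi
    simp at hi
  · have h₁ := Finset.single_le_sum (f := fun r : PRule Pred (Term Const) =>
      r.body.length + (((r.head :: r.body).flatMap Atom.vars).sum + 1))
      (fun _ _ => Nat.zero_le _) h
    have h₂ : i ≤ ((r.head :: r.body).flatMap Atom.vars).sum :=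
      List.le_sum_of_mem (List.mem_flatMap.2 ⟨A, hA, hi⟩)
    simp only [sizeBound]
    omega

variable [DecidableEq Pred] [DecidableEq Const] [Inhabited Const]

omit [Fintype Pred] [DecidableEq Pred] in
theorem length_toList_herbrand_le : P.herbrand.toList.length ≤ P.dbSize + 1 := by
  rw [Finset.length_toList, herbrand, dbSize]
  split_ifs <;> simp

omit [DecidableEq Pred] in
-- The 2 is one for the possible arbitrary constant and one for the positive base in
-- `length_tuples_le`.
theorem ncard_base_le : P.base.ncard ≤
    Fintype.card Pred * (P.dbSize + 2) ^ sizeBound arity P.properRules := by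
  classical
  have h : ((Naive.groundAtoms arity Finset.univ.toList P.herbrand.toList).toFinset :
      Set (Atom Pred Const)) = P.base := by
    ext A
    simp [Naive.mem_groundAtoms P]
  rw [← h, Set.ncard_coe_finset]
  refine (List.toFinset_card_le _).trans ?_
  have := Naive.length_groundAtoms_le (Finset.univ : Finset Pred).toList
    P.length_toList_herbrand_le (arity_le_sizeBound (arity := arity) P.properRules)
  simpa using this

omit [Fintype Pred] [DecidableEq Pred] in
theorem exists_base_of_isFact {r : PRule Pred (Term Const)} (hr : r ∈ P.rules) (hf : r.IsFact) :
    ∃ A ∈ P.base, r.head = ⟨A.pred, A.args.map Term.const⟩ := by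
  have hnv : ∀ i, Term.var i ∉ r.head.args := fun i hi =>
    List.eq_nil_iff_forall_not_mem.1 (P.vars_eq_nil_of_isFact hr hf) i
      (List.mem_flatMap.2 ⟨_, hi, by simp [Term.vars]⟩)
  refine ⟨r.head.subst fun _ => default, ⟨?_, fun c hc => ?_⟩, ?_⟩
  · simpa [Atom.subst] using P.arity_eq r hr r.head (by simp)
  · obtain ⟨t, ht, rfl⟩ := List.mem_map.1 hc
    cases t with
    | var i => exact (hnv i ht).elim
    | const c =>
      have hc : c ∈ P.consts := by
        refine Finset.mem_biUnion.2 ⟨r, hr, List.mem_toFinset.2 ?_⟩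
        exact List.mem_flatMap.2 ⟨r.head, by simp, List.mem_flatMap.2 ⟨.const c, ht, by simp [Term.consts]⟩⟩
      rw [herbrand, if_neg (Finset.ne_empty_of_mem hc)]
      exact hc
  · apply Atom.ext
    · rfl
    · simp only [Atom.subst, List.map_map]
      conv_lhs => rw [← List.map_id r.head.args]
      refine List.map_congr_left fun t ht => ?_
      cases t with
      | var i => exact (hnv i ht).elim
      | const c => rfl

omit [DecidableEq Pred] in
-- Each fact asserts an atom of the Herbrand base, and each such atom carries at most `m` facts.
theorem card_rules_le {m : ℕ} (hm : ∀ A, (P.factsFor A).card ≤ m) :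
    P.rules.card ≤ P.properRules.card + P.base.ncard * m := by
  classical
  have hsub : P.rules ⊆ P.properRules ∪
      P.base_finite.toFinset.biUnion fun A => P.factsFor ⟨A.pred, A.args.map Term.const⟩ := by
    intro r hr
    rw [Finset.mem_union]
    rcases P.isFact_or_mem_properRules hr with h | h
    · obtain ⟨A, hA, e⟩ := P.exists_base_of_isFact hr h
      exact Or.inr (Finset.mem_biUnion.2 ⟨A, by simpa using hA, by simp [factsFor, hr, h, e]⟩)
    · exact Or.inl h
  refine (Finset.card_le_card hsub).trans ((Finset.card_union_le _ _).trans ?_)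
  rw [Set.ncard_eq_toFinset_card _ P.base_finite]
  exact Nat.add_le_add_left (Finset.card_biUnion_le_card_mul _ _ _ fun A _ => hm _) _

end

end PProgram

/-! ### Polynomiality of the cost bounds -/

/-- A function of natural numbers that is given by a polynomial. -/
def IsPolynomial (f : ℕ → ℕ) : Prop := ∃ q : Polynomial ℕ, ∀ n, q.eval n = f n

namespace IsPolynomial

theorem const (c : ℕ) : IsPolynomial fun _ => c := ⟨.C c, by simp⟩

theorem id : IsPolynomial fun n => n := ⟨.X, by simp⟩

theorem add {f g : ℕ → ℕ} : IsPolynomial f → IsPolynomial g → IsPolynomial fun n => f n + g n :=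
  fun ⟨p, hp⟩ ⟨q, hq⟩ => ⟨p + q, by simp [hp, hq]⟩

theorem mul {f g : ℕ → ℕ} : IsPolynomial f → IsPolynomial g → IsPolynomial fun n => f n * g n :=
  fun ⟨p, hp⟩ ⟨q, hq⟩ => ⟨p * q, by simp [hp, hq]⟩

theorem pow {f : ℕ → ℕ} (w : ℕ) : IsPolynomial f → IsPolynomial fun n => f n ^ w :=
  fun ⟨p, hp⟩ => ⟨p ^ w, by simp [hp]⟩

/-- The size `w` does not vary with the data, so the powers that occur have constant exponents. -/
theorem setupCost {L u : ℕ → ℕ} (w p : ℕ) (hL : IsPolynomial L) (hu : IsPolynomial u) :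
    IsPolynomial fun n => Naive.setupCost w p (L n) (u n) := by
  unfold Naive.setupCost Naive.instancesCost
  repeat' first
    | exact const _
    | exact hL
    | exact hu
    | apply add
    | apply mul
    | apply pow

theorem iterationCost {A G : ℕ → ℕ} (w : ℕ) (hA : IsPolynomial A) (hG : IsPolynomial G) :
    IsPolynomial fun n => Naive.iterationCost w (A n) (G n) := by
  unfold Naive.iterationCost
  repeat' first
    | exact const _
    | exact hA
    | exact hG
    | apply add
    | apply mul

end IsPolynomial

end PDatalog

/-! ### Assembly of the bounds -/

open PDatalog in
theorem theorem7p2 {Pred Const : Type} [Fintype Pred] [DecidableEq Pred]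
    [DecidableEq Const] [Inhabited Const] (arity : Pred → ℕ)
    (R : Finset (PRule Pred (Term Const))) (modes : Pred → Mode) (m : ℕ) :
    ∃ q : Polynomial ℕ, ∀ P : PProgram Pred Const arity,
      P.properRules = R → P.disj = modes → (∀ A, (P.factsFor A).card ≤ m) →
      (∀ p, P.Recursive p → P.disj p = Mode.pc) →
      ∃ v : P.Valuation, IsLeast {u | P.immCons u = u} v ∧
        ∀ (preds : List Pred) (rules : List (PRule Pred (Term Const))),
          preds.Nodup → (∀ p, p ∈ preds) → rules.Nodup → (∀ r, r ∈ rules ↔ r ∈ P.rules) →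
          ∃ (s : ℕ) (costs : List ℕ) (out : Naive.Table Pred Const),
            Naive.Halts arity P.disj preds rules s costs out ∧
            P.immCons^[costs.length] P.falseVal = v ∧
            (∀ A c, (A, c) ∈ out ↔ ∃ h : A ∈ P.base, v ⟨A, h⟩ = c) ∧
            costs.length ≤ q.eval P.dbSize ∧
            (∀ t ∈ costs, t ≤ q.eval P.dbSize) ∧
            s + costs.sum ≤ q.eval P.dbSize := by
  classical
  set w := PProgram.sizeBound arity R with hw
  set a := Fintype.card Pred with ha
  -- Bounds in the number of constants: `A` for ground atoms, `L` for rules, `G` for ground rules,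
  -- `S` for the cost of the set-up, `I` for that of an iteration.
  let A : ℕ → ℕ := fun n => a * (n + 2) ^ w
  let L : ℕ → ℕ := fun n => R.card + A n * m
  let G : ℕ → ℕ := fun n => L n * (n + 2) ^ w
  let S : ℕ → ℕ := fun n => Naive.setupCost w a (L n) (n + 1)
  let I : ℕ → ℕ := fun n => Naive.iterationCost w (A n) (G n)
  have hn2 : IsPolynomial fun n => (n + 2) ^ w := .pow w (.add .id (.const 2))
  have hA : IsPolynomial A := .mul (.const a) hn2
  have hL : IsPolynomial L := .add (.const _) (.mul hA (.const m))
  have hG : IsPolynomial G := .mul hL hn2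
  have hS : IsPolynomial S := .setupCost w a hL (.add .id (.const 1))
  have hI : IsPolynomial I := .iterationCost w hA hG
  have hA1 : IsPolynomial fun n => A n + 1 := .add hA (.const 1)
  -- The polynomial is S + (A + 1)(I + 1). The factor I + 1 in place of I makes it dominate the
  -- number A + 1 of iterations as well as their total cost.
  obtain ⟨q, hq⟩ := (hS.add (hA1.mul (hI.add (.const 1))))
  refine ⟨q, fun P hR hmodes hm hrec => ?_⟩
  subst hR
  have hfix := P.stage_card_base hrec
  -- The fixpoint is the stage indexed by the size of the base, chosen before any listing of
  -- predicates and rules.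
  refine ⟨_, P.isLeast_stage hfix, fun preds rules hpnd hpreds hrnd hrules => ?_⟩
  set n := P.dbSize with hn
  have hpl : preds.length = a := by
    rw [ha, ← List.toFinset_card_of_nodup hpnd, ← Finset.card_univ]
    congr 1
    ext p
    simp [hpreds]
  have hbase : P.base.ncard ≤ A n := P.ncard_base_le
  have hrl : rules.length ≤ L n := by
    have : rules.toFinset = P.rules := by ext r; simp [hrules]
    rw [← List.toFinset_card_of_nodup hrnd, this]
    exact (P.card_rules_le hm).trans (Nat.add_le_add_left (Nat.mul_le_mul_right _ hbase) _)
  have hsize : ∀ r ∈ rules, r.SizeLE w := fun r hr => P.sizeLE_sizeBound ((hrules r).1 hr)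
  have hvars : ∀ r ∈ rules, ∀ A ∈ r.head :: r.body, ∀ i ∈ A.vars, i < w := fun r hr _ hA _ hi =>
    P.vars_lt_sizeBound ((hrules r).1 hr) hA hi
  have hu := Naive.length_herbrandList_le P hrules
  have har := PProgram.arity_le_sizeBound (arity := arity) P.properRules
  have hmem := Naive.mem_groundAtoms P hpreds (Naive.mem_herbrandList P hrules)
  have hset := Naive.time_setup_le (arity := arity) preds hrl hu hsize hvars har
  rw [hpl] at hset
  have hiter : ∀ v, (Naive.iteration P.disj (Naive.groundRules rules) (Naive.tableOf P
      (Naive.groundAtoms arity preds (Naive.herbrandList rules)) v)).time ≤ I n := fun v =>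
    Naive.time_iteration_le P.disj
      (by rw [Naive.tableOf, List.length_map]
          exact (Naive.length_groundAtoms_le preds hu har).trans (by rw [hpl]))
      (Naive.length_groundRules_le hrl hu hvars)
      fun g hg => Naive.sizeLE_of_mem_groundRules hsize hg
  obtain ⟨costs, hloop, hcfix, hlen, hcosts⟩ := Naive.exists_loop P hmem
    (Naive.nodup_groundRules rules) (Naive.mem_groundRules P hrules) hiter P.base.ncard 0
    (by simpa using hfix)
  simp only [Nat.zero_add] at hloop hcfix
  -- Evaluation may halt at a different stage, but both stages are least fixpoints.
  have hv : P.stage costs.length = P.stage P.base.ncard :=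
    (P.isLeast_stage ((P.stage_succ _).trans hcfix)).unique (P.isLeast_stage hfix)
  have htab : (Naive.setup arity preds rules).val.2 = Naive.tableOf P
      (Naive.groundAtoms arity preds (Naive.herbrandList rules)) (P.stage 0) := by
    rw [Naive.val_setup, Naive.tableOf]
    refine List.map_congr_left fun A hA => ?_
    rw [P.value_of_mem ((hmem A).1 hA)]
    rfl
  have hlen' : costs.length ≤ A n + 1 := hlen.trans (Nat.succ_le_succ hbase)
  have hsum : costs.sum ≤ (A n + 1) * I n := by
    refine (List.sum_le_card_nsmul _ _ hcosts).trans ?_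
    rw [smul_eq_mul]
    exact Nat.mul_le_mul_right _ hlen'
  have hq' : q.eval n = S n + ((A n + 1) * I n + (A n + 1)) := by rw [hq]; ring
  have hA0 : I n ≤ (A n + 1) * I n := Nat.le_mul_of_pos_left _ (Nat.succ_pos _)
  refine ⟨_, costs, Naive.tableOf P (Naive.groundAtoms arity preds (Naive.herbrandList rules))
    (P.stage costs.length), ⟨rfl, ?_⟩, hv, ?_, ?_, ?_, ?_⟩
  · rw [htab, Naive.val_setup]
    exact hloop
  · intro A c
    rw [Naive.mem_tableOf P hmem, hv]
  · rw [hq']; omega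
  · intro t ht
    have := hcosts t ht
    rw [hq']; omega
  · have : (Naive.setup arity preds rules).time ≤ S n := hset
    rw [hq']; omega
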